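/- Setting. Let $d\in\{1,2,3\}$, $p\in\{1,\dots,7\}$, and let $0<\lambda_1\le\lambda_2\le\cdots$ be the eigenvalues, counted with multiplicity, of the problem: find $\lambda$ and $0\ne u\in H^1_0((0,1)^d)$ with $(\nabla u,\nabla v)=\lambda\,(u,v)$ for all $v\in H_0^1((0,1)^d)$. Discretization. For positive integers $N_1,\dots,N_d$ let $h_k=1/N_k$ and $h=(\sum_k h_k^2)^{1/2}$, and let $B_a=\prod_k B^p_{a_k}(x_k)$, $a\in\mathbb Z^d$, be the tensor product B-splines of degree $p$ with the non-repeated uniform knots $h_k\mathbb Z$ in direction $k$ (maximal continuity $C^{p-1}$). For a quadrature rule $Q$ on $[0,1]$ let $$\tilde a_h(w,v)=\sum_K\mathcal Q_K(\nabla w\cdot\nabla v),\qquad \tilde b_h(w,v)=\sum_K\mathcal Q_K(wv),$$ where $K$ runs over the mesh cells $\prod_k[c_kh_k,(c_k+1)h_k]$, $c\in\mathbb Z^d$, $\mathcal Q_K$ is the $d$-fold tensor product of $Q$ mapped affinely to $K$, and gradients at nodes of $K$ are those of the restriction to $K$. With $G_n$ and $GL_n$ the $n$-point Gauss–Legendre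 and Gauss–Lobatto rules, the optimally blended rule $O_p$ is either of $$G_{p+1}+C_{1,p}\,(GL_{p+1}-G_{p+1}),\qquad G_{p+1}+C_{2,p}\,(G_{p+1}-G_p),$$ where for $p=1,\dots,7$ $$C_{1,p}=\tfrac12,\ \tfrac23,\ \tfrac52,\ \tfrac{84}5,\ 175,\ \tfrac{91212}{35},\ \tfrac{105105}2,\qquad C_{2,p}=1,\ 1,\ \tfrac{10}3,\ 21,\ 210,\ \tfrac{30404}{10},\ 60060 .$$ Approximate squared frequencies. For $Q=O_p$ and real wave numbers $\kappa_1,\dots,\kappa_d$ with $\sum_k\kappa_k^2=\lambda_j$, the approximate squared frequency $\tilde\lambda^{p,h}_{O_p}$ belonging to $\lambda_j$ (and $\kappa$) is the real number $\tilde\lambda$ for which the discrete wave $U=\sum_{a}e^{i\sum_k a_k\kappa_kh_k}B_a$ satisfies the discrete equations away from the boundary, i.e. on the mesh continued to all of $\mathbb R^d$, $$\tilde a_h(U,B_b)=\tilde\lambda\,\tilde b_h(U,B_b)\qquad\text{for all } b\in\mathbb Z^d .$$ (For $d=1$ this means $\kappa_1=\pm\sqrt{\lambda_j}$.) Theorem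 (eigenvalue superconvergence). For all $d$ and $p$ as above there is a constant $C$, depending only on $d$ and $p$, such that for every $j\ge1$, every mesh, and $\tilde\lambda_j^h=\tilde\lambda^{p,h}_{O_p}$ (for either form of $O_p$ and any such $\kappa$): if $\max\{\sqrt{\lambda_j}\,h,\ \sqrt{\tilde\lambda_j^h}\,h\}<1$, then $$|\tilde\lambda_j^h-\lambda_j|\le C\,h^{2p+2}\,\lambda_j^{p+2}.$$ -/

import Mathlib

noncomputable section

namespace IGA

/-! ## The exact eigenvalue problem on the unit cube -/

/-- The open unit cube `(0,1)^d`. -/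
def cube (d : ℕ) : Set (Fin d → ℝ) := Set.pi Set.univ fun _ => Set.Ioo 0 1

/-- Lebesgue measure on the open unit cube. -/
def cubeVol (d : ℕ) : MeasureTheory.Measure (Fin d → ℝ) :=
  MeasureTheory.volume.restrict (cube d)

/-- `u` belongs to `H^1_0((0,1)^d)` and has weak gradient `G`: the pair `(u, G)` is a limit in `L^2`
of pairs `(φ, ∇φ)` with `φ` smooth and compactly supported in the open cube. -/
def MemH10 {d : ℕ} (u : (Fin d → ℝ) → ℝ) (G : Fin d → (Fin d → ℝ) → ℝ) : Prop :=
  MeasureTheory.MemLp u 2 (cubeVol d) ∧ (∀ k, MeasureTheory.MemLp (G k) 2 (cubeVol d)) ∧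
  ∀ ε : ENNReal, 0 < ε → ∃ φ : (Fin d → ℝ) → ℝ,
    ContDiff ℝ (⊤ : ℕ∞) φ ∧ HasCompactSupport φ ∧ tsupport φ ⊆ cube d ∧
    MeasureTheory.eLpNorm (fun x => u x - φ x) 2 (cubeVol d) < ε ∧
    ∀ k, MeasureTheory.eLpNorm (fun x => G k x - fderiv ℝ φ x (Pi.single k 1)) 2 (cubeVol d) < ε

/-- `(lam, u)` is an eigenpair of the variational problem `a(u, v) = lam b(u, v)` for all
`v ∈ H^1_0`, with `a(u, v) = (∇u, ∇v)`, `b(u, v) = (u, v)`, and `u` nonzero. -/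
def IsEigenpair {d : ℕ} (lam : ℝ) (u : (Fin d → ℝ) → ℝ) : Prop :=
  (¬ u =ᵐ[cubeVol d] 0) ∧ ∃ G, MemH10 u G ∧
    ∀ v H, MemH10 v H →
      ∑ k, ∫ x, G k x * H k x ∂(cubeVol d) = lam * ∫ x, u x * v x ∂(cubeVol d)

/-- The `j`-th eigenvalue (`j ≥ 1`, increasing order, counted with multiplicity): the least `μ` for
which there are `j` `L^2`-orthonormal eigenfunctions with eigenvalues at most `μ`. -/
def eigenvalue (d j : ℕ) : ℝ :=
  sInf {μ : ℝ | ∃ (lam : Fin j → ℝ) (u : Fin j → (Fin d → ℝ) → ℝ),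
    (∀ i, IsEigenpair (lam i) (u i) ∧ lam i ≤ μ) ∧
    ∀ i l, ∫ x, u i x * u l x ∂(cubeVol d) = if i = l then 1 else 0}

/-! ## Quadrature rules on the reference interval `[0,1]` -/

/-- A quadrature rule on `[0,1]`: a finitely supported function which assigns to each node its
weight.  Linear combinations of rules are linear combinations of such functions. -/
abbrev Rule := ℝ →₀ ℝ

/-- The interpolatory rule on `[0,1]` with node set `s`: the weight of a node is the integral of
its Lagrange basis polynomial. -/
def interpolatory (s : Finset ℝ) : Rule :=
  ∑ x ∈ s, Finsupp.single x (∫ t in (0 : ℝ)..1, (Lagrange.basis s id x).eval t)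

/-- The `n`-point Gauss-Legendre rule `G_n` on `[0,1]`: the nodes are the zeros of the Legendre
polynomial of degree `n`, shifted to `[0,1]`. -/
def gaussLegendre (n : ℕ) : Rule :=
  interpolatory ((Polynomial.shiftedLegendre n).aroots ℝ).toFinset

/-- The `n`-point Gauss-Lobatto rule `GL_n` on `[0,1]` (`n ≥ 2`): the nodes are the two end points
and the zeros of the derivative of the shifted Legendre polynomial of degree `n - 1`. -/
def gaussLobatto (n : ℕ) : Rule :=
  interpolatory
    ({0, 1} ∪ ((Polynomial.derivative (Polynomial.shiftedLegendre (n - 1))).aroots ℝ).toFinset)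

/-- The coefficients `C_{1,p}`, `p = 1, …, 7`, of the optimal blending of `G_{p+1}` with
`GL_{p+1}`. -/
def blendLobatto : ℕ → ℝ
  | 1 => 1 / 2
  | 2 => 2 / 3
  | 3 => 5 / 2
  | 4 => 84 / 5
  | 5 => 175
  | 6 => 91212 / 35
  | 7 => 105105 / 2
  | _ => 0

/-- The coefficients `C_{2,p}`, `p = 1, …, 7`, of the optimal blending of `G_{p+1}` with `G_p`. -/
def blendGauss : ℕ → ℝ
  | 1 => 1
  | 2 => 1
  | 3 => 10 / 3
  | 4 => 21
  | 5 => 210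
  | 6 => 30404 / 10
  | 7 => 60060
  | _ => 0

/-- The two optimally blended rules `O_p`. -/
def optimalRules (p : ℕ) : Set Rule :=
  {gaussLegendre (p + 1) + blendLobatto p • (gaussLobatto (p + 1) - gaussLegendre (p + 1)),
   gaussLegendre (p + 1) + blendGauss p • (gaussLegendre (p + 1) - gaussLegendre p)}

/-! ## B-splines of maximal continuity on a uniform tensor product mesh -/

/-- The B-spline basis function `B_a^p` for the knots `ξ` (Cox-de Boor recursion). -/
def bspline (ξ : ℤ → ℝ) : ℕ → ℤ → ℝ → ℝ
  | 0, a, x => if ξ a ≤ x ∧ x < ξ (a + 1) then 1 else 0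
  | p + 1, a, x =>
      (x - ξ a) / (ξ (a + p + 1) - ξ a) * bspline ξ p a x +
      (ξ (a + p + 2) - x) / (ξ (a + p + 2) - ξ (a + 1)) * bspline ξ p (a + 1) x

/-- The tensor product B-spline of degree `p` and index `a` on the uniform mesh with (non-repeated)
knots `h_k ℤ` in direction `k`. -/
def basisFun {d : ℕ} (p : ℕ) (h : Fin d → ℝ) (a : Fin d → ℤ) (x : Fin d → ℝ) : ℝ :=
  ∏ k, bspline (fun n => n * h k) p (a k) (x k)

/-! ## Bilinear forms with quadrature -/

/-- The affine map from the reference cell `[0,1]^d` to the mesh cell `∏ [c_k h_k, (c_k+1) h_k]`. -/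
def cellPoint {d : ℕ} (h : Fin d → ℝ) (c : Fin d → ℤ) (t : Fin d → ℝ) : Fin d → ℝ :=
  fun k => (c k + t k) * h k

/-- The partial derivative in direction `k` of the restriction of `f` to the closed mesh cell with
index `c` (one-sided at nodes on the boundary of the cell, where for `p = 1` the derivative of
a spline jumps). -/
def cellPartial {d : ℕ} (h : Fin d → ℝ) (c : Fin d → ℤ) (k : Fin d) (f : (Fin d → ℝ) → ℝ)
    (x : Fin d → ℝ) : ℝ :=
  derivWithin (fun s => f (Function.update x k s)) (Set.Icc (c k * h k) ((c k + 1) * h k)) (x k)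

/-- The form `ã_h(w, v)`: on every cell, `∇w · ∇v` is integrated by the tensor product of the
one-dimensional rule `Q`, mapped to the cell.  (It is used for compactly supported `w`, `v`, so that
only finitely many cells contribute.) -/
def stiffForm {d : ℕ} (Q : Rule) (h : Fin d → ℝ) (w v : (Fin d → ℝ) → ℝ) : ℝ :=
  ∑' c : Fin d → ℤ, ∑ t ∈ Fintype.piFinset (fun _ : Fin d => Q.support),
    ((∏ k, h k) * ∏ k, Q (t k)) *
      ∑ k, cellPartial h c k w (cellPoint h c t) * cellPartial h c k v (cellPoint h c t)

/-- The form `b̃_h(w, v)`: on every cell, `w v` is integrated by the tensor product of the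
one-dimensional rule `Q`, mapped to the cell. -/
def massForm {d : ℕ} (Q : Rule) (h : Fin d → ℝ) (w v : (Fin d → ℝ) → ℝ) : ℝ :=
  ∑' c : Fin d → ℤ, ∑ t ∈ Fintype.piFinset (fun _ : Fin d => Q.support),
    ((∏ k, h k) * ∏ k, Q (t k)) * (w (cellPoint h c t) * v (cellPoint h c t))

/-! ## Spectrum analysis -/

/-- The coefficient `U^a = exp(i ∑ a_k κ_k h_k)` of the discrete plane wave with wave numbers
`κ_k`. -/
def waveCoeff {d : ℕ} (h κ : Fin d → ℝ) (a : Fin d → ℤ) : ℂ :=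
  Complex.exp (Complex.I * ((∑ k, (a k : ℝ) * κ k * h k : ℝ) : ℂ))

/-- `lamt` is the approximate squared frequency of the `p`-th order method with quadrature rule `Q`
for the wave numbers `κ`: the discrete wave `U = ∑_a U^a B_a` solves
`ã_h(U, B_b) = lamt b̃_h(U, B_b)` for all `b`.  The forms are expanded in the basis, and for
given `b` only finitely many terms are nonzero.  The mesh is continued to all of `ℝ^d`, so that
every basis function is away from the boundary. -/
def IsApproxSqFreq {d : ℕ} (p : ℕ) (Q : Rule) (h κ : Fin d → ℝ) (lamt : ℝ) : Prop :=
  ∀ b : Fin d → ℤ,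
    ∑' a : Fin d → ℤ, waveCoeff h κ a * (stiffForm Q h (basisFun p h a) (basisFun p h b) : ℂ) =
      (lamt : ℂ) *
        ∑' a : Fin d → ℤ, waveCoeff h κ a * (massForm Q h (basisFun p h a) (basisFun p h b) : ℂ)

end IGA

end

/-!
# Superconvergence of the eigenvalues for optimally blended quadratures

Every wave number enters only through the phase `θ = κ h` in its coordinate direction.  On a tensor
product mesh the discrete equations for a plane wave factor (`stiffForm_basisFun`,
`massForm_basisFun`, `sum_wave_form1`), so that the approximate squared frequency is
`∑ₖ hₖ⁻² K(θₖ) / M(θₖ)` with the one-dimensional symbols `K(θ) = Q(|W'|²)` and `M(θ) = Q(|W|²)`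
(`IsApproxSqFreq.eq_sum`).  Here `W = W_p` is the exponential spline `∑ᵢ zⁱ Pᵢ`, `z = e^{-iθ}`,
built from the polynomial pieces `Pᵢ` of the cardinal B-spline.  It remains to show that `K / M - θ²` is
of order `θ^{2p+4}`, and that `M` does not vanish.

*Symbols with exact integration.*  The relations `W_{p+1}' = (1 - z) W_p` and `W_{p+1}(0) =
z W_{p+1}(1)` give the Fourier coefficients of `e^{-iθt} W_p` by integration by parts, and
Parseval's identity gives `∫ |W_p|² = ∑ₙ (s / (θ + 2πn)²)^{p+1}` with `s = |1 - z|² = 2 - 2 cos θ`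
(`hasSum_unitIntegral_wave`).  Hence `∫ |W_p'|² - θ² ∫ |W_p|²` is a sum over `n ≠ 0`, whose leading
term is `s^{p+1} ∑_{n ≠ 0} (2πn)^{-2p} = s^{p+1} |B_{2p}| / (2p)!`.  The next term is odd in `n` and
sums to zero (`exists_dispersion_bound`).

*Quadrature error.*  All rules in question integrate polynomials of degree below `2p` exactly, so
`K` carries no error, and the error of `M` is the error of the rule at `x^{2p}` times the leading
coefficient `s^p / (p!)²` of `|W|²`.  This error follows from the orthogonality of the Legendre
polynomials, and of their derivatives for the weight `x (1 - x)` (`quad_gaussLegendre`,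
`quad_gaussLobatto`).  The blending coefficients are the ones for which it equals
`(p!)² |B_{2p}| / (2p)!` (`blendGauss_mul_gaussError`).  Thus `M = ∫ |W|² + s^p |B_{2p}| / (2p)!` is
positive, and the leading terms of the dispersion error cancel.
-/

noncomputable section

namespace IGA

open Polynomial

/-! ### Integration of polynomials over the unit interval -/

/-- Integration over `[0, 1]` as a linear functional on real polynomials. -/
def unitIntegral : ℝ[X] →ₗ[ℝ] ℝ where
  toFun f := ∫ t in (0 : ℝ)..1, f.eval t
  map_add' f g := by
    simp only [eval_add]
    exact intervalIntegral.integral_add (f.continuous.intervalIntegrable _ _)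
      (g.continuous.intervalIntegrable _ _)
  map_smul' c f := by simp

lemma unitIntegral_apply (f : ℝ[X]) : unitIntegral f = ∫ t in (0 : ℝ)..1, f.eval t := rfl

lemma unitIntegral_derivative (f : ℝ[X]) :
    unitIntegral (derivative f) = f.eval 1 - f.eval 0 :=
  intervalIntegral.integral_eq_sub_of_hasDerivAt (fun x _ => f.hasDerivAt x)
    ((derivative f).continuous.intervalIntegrable _ _)

lemma unitIntegral_derivative_mul (f g : ℝ[X]) (h1 : f.eval 1 = 0) (h0 : f.eval 0 = 0) :
    unitIntegral (derivative f * g) = -unitIntegral (f * derivative g) := by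
  have h := unitIntegral_derivative (f * g)
  rw [derivative_mul, map_add] at h
  simp only [eval_mul, h1, h0, zero_mul, sub_zero] at h
  linarith

lemma exists_eval_ne_zero_mem_Ioo {f : ℝ[X]} (hf : f ≠ 0) :
    ∃ x ∈ Set.Ioo (0 : ℝ) 1, f.eval x ≠ 0 := by
  by_contra! h
  exact hf (f.eq_zero_of_infinite_isRoot ((Set.Ioo_infinite zero_lt_one).mono h))

lemma unitIntegral_pos {f : ℝ[X]} (hf : ∀ x ∈ Set.Icc (0 : ℝ) 1, 0 ≤ f.eval x) (h0 : f ≠ 0) :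
    0 < unitIntegral f := by
  obtain ⟨x, hx, hne⟩ := exists_eval_ne_zero_mem_Ioo h0
  refine intervalIntegral.integral_pos zero_lt_one f.continuous.continuousOn
    (fun y hy => hf y (Set.Ioc_subset_Icc_self hy)) ⟨x, Set.Ioo_subset_Icc_self hx, ?_⟩
  exact lt_of_le_of_ne (hf x (Set.Ioo_subset_Icc_self hx)) hne.symm

/-! ### Zeros of orthogonal polynomials -/

/-- A polynomial orthogonal to all polynomials of lower degree has no nonconstant factor of
constant sign on `[0, 1]`: its product with the cofactor would have a nonzero integral. -/
lemma not_nonneg_factor {w f g q : ℝ[X]} (hw : ∀ x ∈ Set.Icc (0 : ℝ) 1, 0 ≤ w.eval x)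
    (hw0 : w ≠ 0) (hf : f ≠ 0)
    (horth : ∀ q : ℝ[X], q.natDegree < f.natDegree → unitIntegral (w * f * q) = 0)
    (hfg : f = g * q) (hg : 0 < g.natDegree)
    (hpos : ∀ x ∈ Set.Icc (0 : ℝ) 1, 0 ≤ g.eval x) : False := by
  have hg0 : g ≠ 0 := by rintro rfl; simp at hg
  have hq0 : q ≠ 0 := by rintro rfl; simp at hfg; exact hf hfg
  have hdeg : q.natDegree < f.natDegree := by rw [hfg, natDegree_mul hg0 hq0]; omega
  have h := horth q hdeg
  have : 0 < unitIntegral (w * f * q) := by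
    refine unitIntegral_pos (fun x hx => ?_) (mul_ne_zero (mul_ne_zero hw0 hf) hq0)
    rw [hfg]
    simp only [eval_mul]
    have := mul_nonneg (mul_nonneg (hw x hx) (hpos x hx)) (mul_self_nonneg (q.eval x))
    linarith
  linarith

/-- The zeros of a polynomial orthogonal to all polynomials of lower degree are real and simple and
lie in the open interval. -/
theorem roots_of_orthogonal {w f : ℝ[X]} (hw : ∀ x ∈ Set.Icc (0 : ℝ) 1, 0 ≤ w.eval x)
    (hw0 : w ≠ 0) (hf : f ≠ 0)
    (horth : ∀ q : ℝ[X], q.natDegree < f.natDegree → unitIntegral (w * f * q) = 0) :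
    f.roots.toFinset.card = f.natDegree ∧ ∀ x ∈ f.roots.toFinset, x ∈ Set.Ioo (0 : ℝ) 1 := by
  have key := fun g q => not_nonneg_factor (g := g) (q := q) hw hw0 hf horth
  -- The sign of the factor may be reversed.
  have key' : ∀ g : ℝ[X], g ∣ f → 0 < g.natDegree →
      (∀ x ∈ Set.Icc (0 : ℝ) 1, g.eval x ≤ 0) → False := by
    rintro g ⟨q, hq⟩ hg hneg
    refine key (-g) (-q) (by rw [hq]; ring) (by rwa [natDegree_neg]) fun x hx => ?_
    rw [eval_neg]
    linarith [hneg x hx]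
  have hsplit : f.Splits := by
    obtain ⟨u, hu⟩ := UniqueFactorizationMonoid.factors_prod hf
    rw [← hu]
    refine (Splits.multisetProd fun g hg => Splits.of_degree_eq_one ?_).mul u.isUnit.splits
    have hgf : g ∣ f := UniqueFactorizationMonoid.dvd_of_mem_factors hg
    replace hg : Irreducible g := UniqueFactorizationMonoid.irreducible_of_factor g hg
    by_contra hdeg
    have hdeg' : 0 < g.natDegree := hg.natDegree_pos
    have hroot : ∀ x : ℝ, g.eval x ≠ 0 := fun x hx =>
      hdeg (degree_eq_one_of_irreducible_of_root hg hx)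
    rcases lt_or_gt_of_ne (hroot 0) with h0 | h0
    · refine key' g hgf hdeg' fun x hx => ?_
      by_contra! hpos
      obtain ⟨y, -, hy⟩ := intermediate_value_Icc hx.1 g.continuous.continuousOn
        (show (0 : ℝ) ∈ Set.Icc (g.eval 0) (g.eval x) from ⟨h0.le, hpos.le⟩)
      exact hroot y hy
    · obtain ⟨q, hq⟩ := hgf
      refine key g q hq hdeg' fun x hx => ?_
      by_contra! hneg
      obtain ⟨y, -, hy⟩ := intermediate_value_Icc' hx.1 g.continuous.continuousOn
        (show (0 : ℝ) ∈ Set.Icc (g.eval x) (g.eval 0) from ⟨hneg.le, h0.le⟩)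
      exact hroot y hy
  have hnodup : f.roots.Nodup := by
    rw [Multiset.nodup_iff_count_le_one]
    intro a
    rw [count_roots]
    by_contra! h2
    obtain ⟨q, hq⟩ := (le_rootMultiplicity_iff hf).1 (show 2 ≤ f.rootMultiplicity a from h2)
    refine key _ q hq ?_ fun x _ => ?_
    · rw [natDegree_pow, natDegree_X_sub_C]; norm_num
    · simp only [eval_pow]; positivity
  refine ⟨?_, fun x hx => ?_⟩
  · rw [Multiset.toFinset_card_of_nodup hnodup, ← hsplit.natDegree_eq_card_roots]
  · have hx' : IsRoot f x := isRoot_of_mem_roots (Multiset.mem_toFinset.1 hx)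
    have hdvd := dvd_iff_isRoot.2 hx'
    by_contra hout
    rw [Set.mem_Ioo, not_and_or, not_lt, not_lt] at hout
    rcases hout with h | h
    · obtain ⟨q, hq⟩ := hdvd
      refine key _ q hq (by rw [natDegree_X_sub_C]; norm_num) fun y hy => ?_
      simp only [eval_sub, eval_X, eval_C]
      linarith [hy.1]
    · refine key' _ hdvd (by rw [natDegree_X_sub_C]; norm_num) fun y hy => ?_
      simp only [eval_sub, eval_X, eval_C]
      linarith [hy.2]

/-! ### Shifted Legendre polynomials -/

/-- The shifted Legendre polynomial of degree `n` with real coefficients. -/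
def legendre (n : ℕ) : ℝ[X] := (shiftedLegendre n).map (Int.castRingHom ℝ)

lemma coeff_legendre (n k : ℕ) :
    (legendre n).coeff k = (-1) ^ k * n.choose k * (n + k).choose n := by
  simp [legendre, coeff_map, coeff_shiftedLegendre]

lemma natDegree_legendre (n : ℕ) : (legendre n).natDegree = n := by
  rw [legendre, natDegree_map_eq_of_injective (RingHom.injective_int _), natDegree_shiftedLegendre]

lemma leadingCoeff_legendre (n : ℕ) :
    (legendre n).leadingCoeff = (-1) ^ n * ((2 * n).choose n : ℝ) := by
  rw [leadingCoeff, natDegree_legendre, coeff_legendre, two_mul, Nat.choose_self]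
  simp

lemma legendre_ne_zero (n : ℕ) : legendre n ≠ 0 := by
  rw [← leadingCoeff_ne_zero, leadingCoeff_legendre]
  have : (0 : ℝ) < (2 * n).choose n := by exact_mod_cast Nat.choose_pos (by omega)
  positivity

/-- Rodrigues' formula. -/
lemma factorial_mul_legendre (n : ℕ) :
    C (n.factorial : ℝ) * legendre n = derivative^[n] ((X * (1 - X)) ^ n) := by
  have h := congrArg (Polynomial.map (Int.castRingHom ℝ)) (factorial_mul_shiftedLegendre_eq n)
  rw [← iterate_derivative_map] at h
  simpa [legendre, mul_pow] using h

lemma unitIntegral_iterate_derivative_mul (n k : ℕ) (hk : k ≤ n) (g : ℝ[X]) :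
    unitIntegral (derivative^[k] ((X * (1 - X)) ^ n) * g) =
      (-1) ^ k * unitIntegral ((X * (1 - X)) ^ n * derivative^[k] g) := by
  induction k generalizing g with
  | zero => simp
  | succ k ih =>
    have hz : ∀ x : ℝ, x * (1 - x) = 0 →
        (derivative^[k] ((X * (1 - X)) ^ n : ℝ[X])).eval x = 0 := by
      intro x hx
      obtain ⟨q, hq⟩ := pow_sub_dvd_iterate_derivative_pow (X * (1 - X) : ℝ[X]) n k
      rw [hq]
      simp [hx, show n - k ≠ 0 by omega]
    rw [Function.iterate_succ_apply', unitIntegral_derivative_mul _ _ (hz 1 (by simp))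
      (hz 0 (by simp)), ih (by omega), Function.iterate_succ_apply]
    ring

theorem legendre_orthogonal (n : ℕ) (q : ℝ[X]) (hq : q.natDegree < n) :
    unitIntegral (legendre n * q) = 0 := by
  have h := unitIntegral_iterate_derivative_mul n n le_rfl q
  rw [iterate_derivative_eq_zero hq, mul_zero, map_zero, mul_zero, ← factorial_mul_legendre,
    mul_assoc, ← smul_eq_C_mul, map_smul, smul_eq_mul] at h
  exact (mul_eq_zero.1 h).resolve_left (by positivity)

/-- The beta integral. -/
lemma unitIntegral_beta (a b : ℕ) :
    unitIntegral (X ^ a * (1 - X) ^ b) =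
      a.factorial * b.factorial / (a + b + 1).factorial := by
  induction b generalizing a with
  | zero =>
    have h := unitIntegral_derivative (X ^ (a + 1))
    simp only [derivative_X_pow, eval_pow, eval_X, one_pow] at h
    rw [← smul_eq_C_mul, map_smul] at h
    simp only [pow_zero, mul_one, Nat.factorial_succ, add_zero, Nat.factorial_zero]
    have : (a.factorial : ℝ) ≠ 0 := by positivity
    push_cast at h ⊢
    simp at h
    field_simp
    linarith
  | succ b ih =>
    have h := unitIntegral_derivative_mul (X ^ (a + 1) * (1 - X) ^ (b + 1)) 1 (by simp) (by simp)
    have hd : derivative (X ^ (a + 1) * (1 - X) ^ (b + 1) : ℝ[X]) =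
        (a + 1 : ℝ) • (X ^ a * (1 - X) ^ (b + 1)) -
          (b + 1 : ℝ) • (X ^ (a + 1) * (1 - X) ^ b) := by
      simp only [smul_eq_C_mul, derivative_mul, derivative_pow, derivative_sub,
        derivative_one, derivative_X]
      simp
      ring
    rw [mul_one, hd, map_sub, map_smul, map_smul, ih (a + 1), derivative_one, mul_zero, map_zero,
      neg_zero] at h
    rw [show a + (b + 1) + 1 = a + 1 + b + 1 by ring]
    simp only [smul_eq_mul, Nat.factorial_succ a, Nat.factorial_succ b] at h ⊢
    push_cast at h ⊢
    have ha : (a + 1 : ℝ) ≠ 0 := by positivity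
    apply mul_left_cancel₀ ha
    linear_combination h

theorem unitIntegral_legendre_mul_X_pow (n : ℕ) :
    unitIntegral (legendre n * X ^ n) = (-1) ^ n * (n.factorial ^ 2 / (2 * n + 1).factorial) := by
  have h := unitIntegral_iterate_derivative_mul n n le_rfl (X ^ n)
  rw [← factorial_mul_legendre, iterate_derivative_X_pow_eq_smul, Nat.descFactorial_self,
    Nat.sub_self, pow_zero, mul_assoc, ← smul_eq_C_mul, map_smul, mul_smul_comm, mul_one,
    mul_pow, map_smul, unitIntegral_beta, ← two_mul] at h
  have : (n.factorial : ℝ) ≠ 0 := by positivity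
  simp only [smul_eq_mul] at h
  apply mul_left_cancel₀ this
  rw [h]
  ring

lemma roots_legendre (n : ℕ) :
    (legendre n).roots.toFinset.card = n ∧
      ∀ x ∈ (legendre n).roots.toFinset, x ∈ Set.Ioo (0 : ℝ) 1 := by
  have h := roots_of_orthogonal (w := 1) (f := legendre n) (by simp) one_ne_zero
    (legendre_ne_zero n) (by simpa [natDegree_legendre] using legendre_orthogonal n)
  rwa [natDegree_legendre] at h

/-- The derivatives of the Legendre polynomials are orthogonal for the weight `x (1 - x)`. -/
lemma unitIntegral_derivative_legendre_mul (n : ℕ) (q : ℝ[X]) :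
    unitIntegral (X * (1 - X) * derivative (legendre n) * q) =
      -unitIntegral (legendre n * derivative (X * (1 - X) * q)) := by
  have h := unitIntegral_derivative_mul (X * (1 - X) * q) (legendre n) (by simp) (by simp)
  rw [mul_comm (legendre n), h, neg_neg]
  congr 1
  ring

lemma natDegree_derivative_legendre (n : ℕ) : (derivative (legendre n)).natDegree = n - 1 := by
  rw [natDegree_derivative, natDegree_legendre]

lemma natDegree_X_mul_one_sub_X : (X * (1 - X) : ℝ[X]).natDegree = 2 := by
  compute_degree!

lemma derivative_legendre_ne_zero {n : ℕ} (hn : 1 ≤ n) : derivative (legendre n) ≠ 0 := by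
  intro h
  have := derivative_eq_zero.1 h
  rw [natDegree_legendre] at this
  omega

lemma derivative_legendre_orthogonal (n : ℕ) (q : ℝ[X]) (hq : q.natDegree < n - 1) :
    unitIntegral (X * (1 - X) * derivative (legendre n) * q) = 0 := by
  rw [unitIntegral_derivative_legendre_mul, legendre_orthogonal, neg_zero]
  rw [natDegree_derivative]
  have := natDegree_mul_le (p := (X * (1 - X) : ℝ[X])) (q := q)
  rw [natDegree_X_mul_one_sub_X] at this
  omega

lemma roots_derivative_legendre {n : ℕ} (hn : 1 ≤ n) :
    (derivative (legendre n)).roots.toFinset.card = n - 1 ∧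
      ∀ x ∈ (derivative (legendre n)).roots.toFinset, x ∈ Set.Ioo (0 : ℝ) 1 := by
  have h := roots_of_orthogonal (w := X * (1 - X)) (f := derivative (legendre n))
    (fun x hx => by simpa using mul_nonneg hx.1 (sub_nonneg.2 hx.2))
    (fun h => by simpa [h] using natDegree_X_mul_one_sub_X)
    (derivative_legendre_ne_zero hn)
    (by rw [natDegree_derivative_legendre]; exact derivative_legendre_orthogonal n)
  rwa [natDegree_derivative_legendre] at h

/-! ### Gauss and Lobatto rules -/

/-- The value of a quadrature rule at a polynomial. -/
def quad (Q : Rule) (g : ℝ[X]) : ℝ := ∑ x ∈ Q.support, Q x * g.eval x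

lemma quad_eq_linearCombination (Q : Rule) (g : ℝ[X]) :
    quad Q g = Finsupp.linearCombination ℝ (fun x => g.eval x) Q := by
  simp [quad, Finsupp.linearCombination_apply, Finsupp.sum]

lemma quad_interpolatory_eq (s : Finset ℝ) (g : ℝ[X]) :
    quad (interpolatory s) g = unitIntegral (Lagrange.interpolate s id fun x => g.eval x) := by
  rw [quad_eq_linearCombination, interpolatory, map_sum, Lagrange.interpolate_apply, map_sum]
  refine Finset.sum_congr rfl fun x _ => ?_
  rw [← smul_eq_C_mul, map_smul, Finsupp.linearCombination_single, unitIntegral_apply, smul_eq_mul,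
    smul_eq_mul, mul_comm]

lemma support_interpolatory_subset (s : Finset ℝ) : (interpolatory s).support ⊆ s := by
  intro x hx
  by_contra h
  refine Finsupp.mem_support_iff.1 hx ?_
  rw [interpolatory, Finsupp.finsetSum_apply]
  exact Finset.sum_eq_zero fun y hy => Finsupp.single_eq_of_ne (by rintro rfl; exact h hy)

/-- An interpolatory rule whose nodal polynomial is orthogonal to the polynomials of degree below
`m` is exact up to one degree less than the number of nodes plus `m`; for that degree its error is
a multiple of the leading coefficient. -/
theorem quad_interpolatory {s : Finset ℝ} {f g : ℝ[X]} {m : ℕ} (hf : f ≠ 0)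
    (hs : ∀ x ∈ s, f.eval x = 0) (hcard : s.card = f.natDegree)
    (horth : ∀ q : ℝ[X], q.degree < m → unitIntegral (f * q) = 0)
    (hg : g.natDegree ≤ f.natDegree + m) :
    quad (interpolatory s) g = unitIntegral g -
      g.coeff (f.natDegree + m) * (unitIntegral (f * X ^ m) / f.leadingCoeff) := by
  have hdm : f * (g / f) + g % f = g := EuclideanDomain.div_add_mod g f
  have hr : (g % f).degree < s.card := by
    rw [hcard, ← degree_eq_natDegree hf]; exact degree_mod_lt g hf
  have hinterp : Lagrange.interpolate s id (fun x => g.eval x) = g % f := by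
    symm
    refine Lagrange.eq_interpolate_of_eval_eq _ (Set.injOn_id _) hr fun x hx => ?_
    conv_rhs => rw [← hdm]
    simp [hs x hx]
  have hq : (g / f).natDegree ≤ m := by
    rcases eq_or_ne (g / f) 0 with h0 | h0
    · simp [h0]
    have h1 := natDegree_mul hf h0
    have h2 : (g % f).natDegree ≤ f.natDegree := natDegree_le_natDegree (degree_mod_lt g hf).le
    have h3 := natDegree_sub_le g (g % f)
    rw [← eq_sub_of_add_eq hdm] at h3
    have h4 := h3.trans (max_le hg (h2.trans (Nat.le_add_right _ m)))
    omega
  have hcoeff : g.coeff (f.natDegree + m) = f.leadingCoeff * (g / f).coeff m := by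
    conv_lhs => rw [← hdm]
    rw [coeff_add, coeff_mul_add_eq_of_natDegree_le le_rfl hq, coeff_natDegree,
      coeff_eq_zero_of_degree_lt (hr.trans_le ?_), add_zero]
    rw [hcard]; exact_mod_cast Nat.le_add_right _ _
  have hlow : (g / f - C ((g / f).coeff m) * X ^ m).degree < (m : WithBot ℕ) := by
    rw [degree_lt_iff_coeff_zero]
    intro k hk
    rcases hk.eq_or_lt with rfl | hk
    · simp
    · rw [coeff_sub, coeff_C_mul_X_pow, if_neg hk.ne',
        coeff_eq_zero_of_natDegree_lt (hq.trans_lt hk), sub_zero]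
  have h := horth _ hlow
  rw [mul_sub, map_sub, ← smul_eq_C_mul, mul_smul_comm, map_smul, smul_eq_mul, sub_eq_zero] at h
  have h2 := congrArg unitIntegral hdm
  rw [map_add, h] at h2
  rw [quad_interpolatory_eq, hinterp, hcoeff]
  have := leadingCoeff_ne_zero.2 hf
  field_simp
  linarith

/-- The error of the `n`-point Gauss rule at `x ^ (2 n)`. -/
def gaussError (n : ℕ) : ℝ :=
  (n.factorial : ℝ) ^ 4 / ((2 * n).factorial * (2 * n + 1).factorial)

lemma unitIntegral_legendre_div (n : ℕ) :
    unitIntegral (legendre n * X ^ n) / (legendre n).leadingCoeff = gaussError n := by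
  have h1 : (((2 * n).choose n : ℕ) : ℝ) = (2 * n).factorial / (n.factorial * n.factorial) := by
    rw [Nat.cast_choose ℝ (by omega), show 2 * n - n = n by omega]
  rw [unitIntegral_legendre_mul_X_pow, leadingCoeff_legendre, h1, gaussError,
    mul_div_mul_left _ _ (by simp)]
  field_simp

theorem quad_gaussLegendre {n : ℕ} {g : ℝ[X]} (hg : g.natDegree ≤ 2 * n) :
    quad (gaussLegendre n) g = unitIntegral g - g.coeff (2 * n) * gaussError n := by
  have hroots : gaussLegendre n = interpolatory (legendre n).roots.toFinset := rfl
  rw [hroots, quad_interpolatory (legendre_ne_zero n) (m := n), unitIntegral_legendre_div,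
    natDegree_legendre, ← two_mul]
  · intro x hx
    exact isRoot_of_mem_roots (Multiset.mem_toFinset.1 hx)
  · rw [(roots_legendre n).1, natDegree_legendre]
  · intro q hq
    rcases eq_or_ne q 0 with rfl | h0
    · simp
    · exact legendre_orthogonal n q ((natDegree_lt_iff_degree_lt h0).2 hq)
  · rw [natDegree_legendre]; omega

lemma support_gaussLegendre (n : ℕ) :
    ∀ x ∈ (gaussLegendre n).support, x ∈ Set.Icc (0 : ℝ) 1 := fun x hx =>
  Set.Ioo_subset_Icc_self ((roots_legendre n).2 x (support_interpolatory_subset _ hx))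

lemma gaussLobatto_eq (n : ℕ) : gaussLobatto (n + 1) =
    interpolatory ({0, 1} ∪ (derivative (legendre n)).roots.toFinset) := by
  simp [gaussLobatto, legendre, aroots_def, derivative_map]

theorem quad_gaussLobatto {n : ℕ} (hn : 1 ≤ n) {g : ℝ[X]} (hg : g.natDegree ≤ 2 * n) :
    quad (gaussLobatto (n + 1)) g =
      unitIntegral g + g.coeff (2 * n) * ((n + 1) / n * gaussError n) := by
  set L := legendre n
  set R := (derivative L).roots.toFinset
  have hroots : gaussLobatto (n + 1) = interpolatory ({0, 1} ∪ R) := gaussLobatto_eq n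
  set f : ℝ[X] := X * (1 - X) * derivative L
  have hX : (X * (1 - X) : ℝ[X]) ≠ 0 := fun h => by simpa [h] using natDegree_X_mul_one_sub_X
  have hf : f ≠ 0 := mul_ne_zero hX (derivative_legendre_ne_zero hn)
  have hdeg : f.natDegree = n + 1 := by
    rw [natDegree_mul hX (derivative_legendre_ne_zero hn), natDegree_X_mul_one_sub_X,
      natDegree_derivative_legendre]
    omega
  have hlead : f.leadingCoeff = -n * L.leadingCoeff := by
    rw [leadingCoeff_mul, leadingCoeff_mul, leadingCoeff_X, leadingCoeff_derivative]
    have : (1 - X : ℝ[X]).leadingCoeff = -1 := by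
      rw [show (1 - X : ℝ[X]) = -(X - C 1) by rw [C_1]; ring, leadingCoeff_neg,
        leadingCoeff_X_sub_C]
    rw [this, natDegree_legendre]
    ring
  have hcard : ({0, 1} ∪ R).card = n + 1 := by
    rw [Finset.card_union_of_disjoint, (roots_derivative_legendre hn).1,
      Finset.card_pair zero_ne_one]
    · omega
    · rw [Finset.disjoint_left]
      intro x hx hxR
      have := (roots_derivative_legendre hn).2 x hxR
      rcases Finset.mem_insert.1 hx with rfl | hx
      · exact lt_irrefl _ this.1
      · rw [Finset.mem_singleton.1 hx] at this
        exact lt_irrefl _ this.2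
  have hmoment : unitIntegral (f * X ^ (n - 1)) = (n + 1) * unitIntegral (L * X ^ n) := by
    obtain ⟨k, rfl⟩ : ∃ k, n = k + 1 := ⟨n - 1, by omega⟩
    have hd : L * derivative (X * (1 - X) * X ^ k) =
        (k + 1 : ℝ) • (L * X ^ k) - (k + 2 : ℝ) • (L * X ^ (k + 1)) := by
      rw [show (X * (1 - X) * X ^ k : ℝ[X]) = X ^ (k + 1) - X ^ (k + 2) by ring, derivative_sub,
        derivative_X_pow, derivative_X_pow]
      simp only [smul_eq_C_mul]
      push_cast
      simp only [C_add, C_1, Polynomial.C_ofNat, map_natCast]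
      ring
    rw [Nat.add_sub_cancel, unitIntegral_derivative_legendre_mul, hd, map_sub, map_smul, map_smul,
      legendre_orthogonal _ _ (by rw [natDegree_X_pow]; omega)]
    push_cast
    simp only [smul_eq_mul]
    ring
  rw [hroots, quad_interpolatory hf (m := n - 1), hmoment, hlead, hdeg,
    show n + 1 + (n - 1) = 2 * n by omega, ← unitIntegral_legendre_div,
    show legendre n = L from rfl]
  · have h1 : L.leadingCoeff ≠ 0 := leadingCoeff_ne_zero.2 (legendre_ne_zero n)
    have h2 : (n : ℝ) ≠ 0 := by positivity
    field_simp
    ring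
  · intro x hx
    rcases Finset.mem_union.1 hx with hx | hx
    · rcases Finset.mem_insert.1 hx with rfl | hx
      · simp [f]
      · simp [f, Finset.mem_singleton.1 hx]
    · have : (derivative L).eval x = 0 := isRoot_of_mem_roots (Multiset.mem_toFinset.1 hx)
      simp [f, this]
  · rw [hcard, hdeg]
  · intro q hq
    rcases eq_or_ne q 0 with rfl | h0
    · simp
    · exact derivative_legendre_orthogonal n q ((natDegree_lt_iff_degree_lt h0).2 hq)
  · rw [hdeg]; omega

lemma support_gaussLobatto {n : ℕ} (hn : 1 ≤ n) :
    ∀ x ∈ (gaussLobatto (n + 1)).support, x ∈ Set.Icc (0 : ℝ) 1 := by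
  intro x hx
  rw [gaussLobatto_eq] at hx
  rcases Finset.mem_union.1 (support_interpolatory_subset _ hx) with h | h
  · rcases Finset.mem_insert.1 h with rfl | h
    · simp
    · simp [Finset.mem_singleton.1 h]
  · exact Set.Ioo_subset_Icc_self ((roots_derivative_legendre hn).2 x h)

/-! ### The blending coefficients -/

lemma bernoulli_even (n : ℕ) : _root_.bernoulli (2 * n) = bernoulli' (2 * n) :=
  bernoulli_eq_bernoulli'_of_ne_one (by omega)

lemma bernoulli'_six : bernoulli' 6 = 1 / 42 := by
  have h5 : bernoulli' 5 = 0 := bernoulli'_eq_zero_of_odd (by decide) (by norm_num)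
  rw [bernoulli'_def]
  norm_num [Finset.sum_range_succ, h5, Nat.choose]

lemma bernoulli'_eight : bernoulli' 8 = -1 / 30 := by
  have h5 : bernoulli' 5 = 0 := bernoulli'_eq_zero_of_odd (by decide) (by norm_num)
  have h7 : bernoulli' 7 = 0 := bernoulli'_eq_zero_of_odd (by decide) (by norm_num)
  rw [bernoulli'_def]
  norm_num [Finset.sum_range_succ, h5, h7, bernoulli'_six, Nat.choose]

lemma bernoulli'_ten : bernoulli' 10 = 5 / 66 := by
  have h5 : bernoulli' 5 = 0 := bernoulli'_eq_zero_of_odd (by decide) (by norm_num)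
  have h7 : bernoulli' 7 = 0 := bernoulli'_eq_zero_of_odd (by decide) (by norm_num)
  have h9 : bernoulli' 9 = 0 := bernoulli'_eq_zero_of_odd (by decide) (by norm_num)
  rw [bernoulli'_def]
  norm_num [Finset.sum_range_succ, h5, h7, h9, bernoulli'_six, bernoulli'_eight, Nat.choose]

lemma bernoulli'_twelve : bernoulli' 12 = -691 / 2730 := by
  have h5 : bernoulli' 5 = 0 := bernoulli'_eq_zero_of_odd (by decide) (by norm_num)
  have h7 : bernoulli' 7 = 0 := bernoulli'_eq_zero_of_odd (by decide) (by norm_num)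
  have h9 : bernoulli' 9 = 0 := bernoulli'_eq_zero_of_odd (by decide) (by norm_num)
  have h11 : bernoulli' 11 = 0 := bernoulli'_eq_zero_of_odd (by decide) (by norm_num)
  rw [bernoulli'_def]
  norm_num [Finset.sum_range_succ, h5, h7, h9, h11, bernoulli'_six, bernoulli'_eight,
    bernoulli'_ten, Nat.choose]

lemma bernoulli'_fourteen : bernoulli' 14 = 7 / 6 := by
  have h5 : bernoulli' 5 = 0 := bernoulli'_eq_zero_of_odd (by decide) (by norm_num)
  have h7 : bernoulli' 7 = 0 := bernoulli'_eq_zero_of_odd (by decide) (by norm_num)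
  have h9 : bernoulli' 9 = 0 := bernoulli'_eq_zero_of_odd (by decide) (by norm_num)
  have h11 : bernoulli' 11 = 0 := bernoulli'_eq_zero_of_odd (by decide) (by norm_num)
  have h13 : bernoulli' 13 = 0 := bernoulli'_eq_zero_of_odd (by decide) (by norm_num)
  rw [bernoulli'_def]
  norm_num [Finset.sum_range_succ, h5, h7, h9, h11, h13, bernoulli'_six, bernoulli'_eight,
    bernoulli'_ten, bernoulli'_twelve, Nat.choose]

/-- The number `|B_{2p}| / (2p)!`. -/
def bernoulliRatio (p : ℕ) : ℝ := (-1) ^ (p + 1) * _root_.bernoulli (2 * p) / (2 * p).factorial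

/-- The blending coefficient is the Bernoulli number which makes the error of the rule at
`x ^ (2 p)` cancel the leading term of the dispersion error. -/
lemma blendGauss_mul_gaussError {p : ℕ} (hp1 : 1 ≤ p) (hp7 : p ≤ 7) :
    blendGauss p * gaussError p = (p.factorial : ℝ) ^ 2 * bernoulliRatio p := by
  rw [bernoulliRatio, bernoulli_even]
  interval_cases p <;>
  norm_num [blendGauss, gaussError, Nat.factorial, bernoulli'_six, bernoulli'_eight,
    bernoulli'_ten, bernoulli'_twelve, bernoulli'_fourteen]

lemma blendLobatto_eq {p : ℕ} (hp1 : 1 ≤ p) (hp7 : p ≤ 7) :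
    blendLobatto p * ((p + 1) / p) = blendGauss p := by
  interval_cases p <;> norm_num [blendGauss, blendLobatto]

theorem quad_optimalRules {p : ℕ} (hp1 : 1 ≤ p) (hp7 : p ≤ 7) {Q : Rule} (hQ : Q ∈ optimalRules p)
    {g : ℝ[X]} (hg : g.natDegree ≤ 2 * p) :
    quad Q g = unitIntegral g + g.coeff (2 * p) * ((p.factorial : ℝ) ^ 2 * bernoulliRatio p) := by
  have h1 : quad (gaussLegendre (p + 1)) g = unitIntegral g := by
    rw [quad_gaussLegendre (by omega), coeff_eq_zero_of_natDegree_lt (by omega)]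
    ring
  have h2 := quad_gaussLegendre hg
  have h3 := quad_gaussLobatto hp1 hg
  rw [← blendGauss_mul_gaussError hp1 hp7]
  rw [quad_eq_linearCombination] at h1 h2 h3 ⊢
  rcases hQ with rfl | rfl
  · rw [map_add, map_smul, map_sub, h1, h3, ← blendLobatto_eq hp1 hp7, smul_eq_mul]
    ring
  · rw [map_add, map_smul, map_sub, h1, h2, smul_eq_mul]
    ring

lemma support_optimalRules {p : ℕ} (hp1 : 1 ≤ p) {Q : Rule} (hQ : Q ∈ optimalRules p) :
    ∀ x ∈ Q.support, x ∈ Set.Icc (0 : ℝ) 1 := by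
  -- The rules whose nodes lie in `[0, 1]` form a submodule.
  have key : Q ∈ Finsupp.supported ℝ ℝ (Set.Icc (0 : ℝ) 1) := by
    have hG : ∀ n, gaussLegendre n ∈ Finsupp.supported ℝ ℝ (Set.Icc (0 : ℝ) 1) :=
      fun n x hx => support_gaussLegendre n x hx
    have hL : gaussLobatto (p + 1) ∈ Finsupp.supported ℝ ℝ (Set.Icc (0 : ℝ) 1) :=
      fun x hx => support_gaussLobatto hp1 x hx
    rcases hQ with rfl | rfl
    · exact add_mem (hG _) (Submodule.smul_mem _ _ (sub_mem hL (hG _)))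
    · exact add_mem (hG _) (Submodule.smul_mem _ _ (sub_mem (hG _) (hG _)))
  exact fun x hx => key hx

/-! ### Polynomial pieces of cardinal B-splines -/

/-- The polynomial, in the local coordinate `t ∈ [0, 1]`, which the uniform B-spline of degree `p`
with index `a` equals on the mesh cell with index `a + i`. -/
def piece : ℕ → ℤ → ℝ[X]
  | 0, i => if i = 0 then 1 else 0
  | p + 1, i => C ((p + 1 : ℝ)⁻¹) *
      ((X + C (i : ℝ)) * piece p i + (C (p + 2 - i : ℝ) - X) * piece p (i - 1))

lemma piece_succ (p : ℕ) (i : ℤ) : (p + 1 : ℝ[X]) * piece (p + 1) i =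
    (X + C (i : ℝ)) * piece p i + (C (p + 2 - i : ℝ) - X) * piece p (i - 1) := by
  have h : (p + 1 : ℝ[X]) = C (p + 1 : ℝ) := by simp
  rw [piece, h, ← mul_assoc, ← C_mul, mul_inv_cancel₀ (by positivity), C_1, one_mul]

lemma piece_eq_zero {p : ℕ} {i : ℤ} (hi : i < 0 ∨ (p : ℤ) < i) : piece p i = 0 := by
  induction p generalizing i with
  | zero => rw [piece, if_neg (by push_cast at hi; omega)]
  | succ p ih =>
    push_cast at hi
    rw [piece, ih (by omega), ih (by omega)]
    simp

lemma natDegree_piece_le (p : ℕ) (i : ℤ) : (piece p i).natDegree ≤ p := by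
  induction p generalizing i with
  | zero => rw [piece]; split_ifs <;> simp
  | succ p ih =>
    rw [piece]
    refine (natDegree_C_mul_le _ _).trans (natDegree_add_le_of_degree_le ?_ ?_)
    · rw [add_comm p 1]
      exact natDegree_mul_le_of_le (natDegree_X_add_C _).le (ih i)
    · rw [add_comm p 1]
      refine natDegree_mul_le_of_le ?_ (ih _)
      refine (natDegree_sub_le _ _).trans ?_
      rw [natDegree_C, natDegree_X]
      simp

lemma derivative_piece (p : ℕ) (i : ℤ) :
    derivative (piece (p + 1) i) = piece p i - piece p (i - 1) := by
  have key : ∀ (p : ℕ), (p + 1 : ℝ[X]) ≠ 0 := fun p => by exact_mod_cast Nat.succ_ne_zero p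
  have hd : ∀ (p : ℕ), derivative (p + 1 : ℝ[X]) = 0 := fun p => by simp
  induction p generalizing i with
  | zero =>
    have h := congrArg derivative (piece_succ 0 i)
    rw [derivative_mul, hd] at h
    have h0 : ∀ j, derivative (piece 0 j) = 0 := fun j => by rw [piece]; split_ifs <;> simp
    simp only [derivative_add, derivative_mul, h0, derivative_sub, derivative_X, derivative_C] at h
    simpa [← sub_eq_add_neg] using h
  | succ p ih =>
    have h := congrArg derivative (piece_succ (p + 1) i)
    rw [derivative_mul, hd, zero_mul, zero_add] at h
    simp only [derivative_add, derivative_mul, ih, derivative_sub, derivative_X,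
      derivative_C] at h
    have h1 := piece_succ p i
    have h2 := piece_succ p (i - 1)
    apply mul_left_cancel₀ (key (p + 1))
    rw [h]
    push_cast at h1 h2 ⊢
    simp only [C_add, C_sub, C_1, map_natCast, map_intCast, Polynomial.C_ofNat] at h1 h2 ⊢
    linear_combination -h1 + h2

lemma eval_piece_succ (p : ℕ) (i : ℤ) (x : ℝ) : (piece (p + 1) i).eval x =
    (p + 1 : ℝ)⁻¹ * ((x + i) * (piece p i).eval x +
      (p + 2 - i - x) * (piece p (i - 1)).eval x) := by
  simp only [piece, eval_mul, eval_add, eval_sub, eval_X, eval_C]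

/-- Continuity of B-splines of positive degree at the knots. -/
lemma piece_eval_one (p : ℕ) (i : ℤ) :
    (piece (p + 1) i).eval 1 = (piece (p + 1) (i + 1)).eval 0 := by
  induction p generalizing i with
  | zero =>
    simp only [piece, eval_mul, eval_add, eval_sub, eval_X, eval_C]
    rcases lt_trichotomy i 0 with hi | rfl | hi
    · rcases eq_or_ne i (-1) with rfl | h1
      · norm_num
      · simp [hi.ne, show i + 1 ≠ 0 by omega, show i - 1 ≠ 0 by omega]
    · norm_num
    · rcases eq_or_ne i 1 with rfl | h1
      · norm_num
      · simp [hi.ne', show i + 1 ≠ 0 by omega, show i - 1 ≠ 0 by omega]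
  | succ p ih =>
    have h := ih (i - 1)
    rw [sub_add_cancel] at h
    rw [eval_piece_succ (p + 1) i, eval_piece_succ (p + 1) (i + 1), ih i, h, add_sub_cancel_right]
    push_cast
    ring

lemma bspline_eq_piece_of_lt {h : ℝ} (hh : 0 < h) (p : ℕ) (a c : ℤ) {t : ℝ} (h0 : 0 ≤ t)
    (h1 : t < 1) :
    bspline (fun n => n * h) p a ((c + t) * h) = (piece p (c - a)).eval t := by
  induction p generalizing a with
  | zero =>
    rw [bspline, piece]
    by_cases hac : c - a = 0
    · have hac' : a = c := by omega
      subst hac'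
      rw [if_pos, if_pos (sub_self _), eval_one]
      constructor
      · nlinarith
      · push_cast; nlinarith
    · rw [if_neg, if_neg hac, eval_zero]
      rintro ⟨h2, h3⟩
      have h4 : (a : ℝ) ≤ c + t := le_of_mul_le_mul_right h2 hh
      have h5 : (c + t : ℝ) < ((a + 1 : ℤ) : ℝ) := lt_of_mul_lt_mul_right h3 hh.le
      have h6 : a < c + 1 := by exact_mod_cast (show (a : ℝ) < c + 1 by linarith)
      have h7 : c < a + 1 := by exact_mod_cast (show (c : ℝ) < ((a + 1 : ℤ) : ℝ) by linarith)
      omega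
  | succ p ih =>
    rw [bspline, ih a, ih (a + 1), piece, show c - (a + 1) = c - a - 1 by ring]
    simp only [eval_mul, eval_add, eval_sub, eval_X, eval_C]
    push_cast
    have hp : (p + 1 : ℝ) ≠ 0 := by positivity
    rw [show (a + p + 1 : ℝ) * h - a * h = (p + 1) * h by ring,
      show (a + p + 2 : ℝ) * h - (a + 1) * h = (p + 1) * h by ring]
    field_simp
    ring

/-- On a closed mesh cell, a B-spline of positive degree is a polynomial. -/
theorem bspline_eq_piece {h : ℝ} (hh : 0 < h) {p : ℕ} (hp : 1 ≤ p) (a c : ℤ) {t : ℝ}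
    (ht : t ∈ Set.Icc (0 : ℝ) 1) :
    bspline (fun n => n * h) p a ((c + t) * h) = (piece p (c - a)).eval t := by
  rcases ht.2.lt_or_eq with h1 | rfl
  · exact bspline_eq_piece_of_lt hh p a c ht.1 h1
  · have h2 := bspline_eq_piece_of_lt hh p a (c + 1) le_rfl zero_lt_one
    obtain ⟨q, rfl⟩ : ∃ q, p = q + 1 := ⟨p - 1, by omega⟩
    rw [piece_eval_one, show c - a + 1 = c + 1 - a by ring, ← h2]
    push_cast
    rw [add_zero]

/-! ### Exponential splines -/

/-- The restriction to the mesh cell with index `0` of the discrete wave `∑ₐ z⁻ᵃ Bₐ`. -/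
def wave (p : ℕ) (z : ℂ) : ℂ[X] :=
  ∑ i ∈ Finset.range (p + 1), C (z ^ i) * (piece p i).map (algebraMap ℝ ℂ)

lemma eval_map_ofReal (f : ℝ[X]) (t : ℝ) :
    (f.map (algebraMap ℝ ℂ)).eval (t : ℂ) = ((f.eval t : ℝ) : ℂ) := by
  rw [eval_map]
  exact eval₂_at_apply (algebraMap ℝ ℂ) t

lemma eval_wave (p : ℕ) (z : ℂ) (t : ℝ) : (wave p z).eval (t : ℂ) =
    ∑ i ∈ Finset.range (p + 1), z ^ i * (((piece p i).eval t : ℝ) : ℂ) := by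
  simp only [wave, eval_finsetSum, eval_mul, eval_C, eval_map_ofReal]

lemma wave_zero (z : ℂ) : wave 0 z = 1 := by simp [wave, piece]

lemma sum_piece_extend (p : ℕ) (f : ℕ → ℂ[X]) :
    ∑ i ∈ Finset.range (p + 2), f i * (piece p i).map (algebraMap ℝ ℂ) =
      ∑ i ∈ Finset.range (p + 1), f i * (piece p i).map (algebraMap ℝ ℂ) := by
  rw [Finset.sum_range_succ, piece_eq_zero (by push_cast; omega)]
  simp

lemma sum_piece_shift (p : ℕ) (f : ℕ → ℂ[X]) :
    ∑ i ∈ Finset.range (p + 2), f i * (piece p ((i : ℤ) - 1)).map (algebraMap ℝ ℂ) =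
      ∑ i ∈ Finset.range (p + 1), f (i + 1) * (piece p i).map (algebraMap ℝ ℂ) := by
  rw [Finset.sum_range_succ', piece_eq_zero (i := ((0 : ℕ) : ℤ) - 1) (by norm_num)]
  simp only [Polynomial.map_zero, mul_zero, add_zero]
  refine Finset.sum_congr rfl fun i _ => ?_
  push_cast
  rw [add_sub_cancel_right]

lemma derivative_wave (p : ℕ) (z : ℂ) :
    derivative (wave (p + 1) z) = C (1 - z) * wave p z := by
  rw [wave, derivative_sum]
  simp only [derivative_mul, derivative_C, zero_mul, zero_add, derivative_map, derivative_piece,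
    Polynomial.map_sub, mul_sub, Finset.sum_sub_distrib]
  rw [sum_piece_extend p fun i => C (z ^ i), sum_piece_shift p fun i => C (z ^ i), C_sub, sub_mul,
    C_1, one_mul, wave, Finset.mul_sum]
  congr 1
  refine Finset.sum_congr rfl fun i _ => ?_
  rw [pow_succ', C_mul, mul_assoc]

/-- The wave is quasiperiodic. -/
lemma wave_eval_one (p : ℕ) (z : ℂ) :
    z * (wave (p + 1) z).eval 1 = (wave (p + 1) z).eval 0 := by
  have h1 := eval_wave (p + 1) z 1
  have h0 := eval_wave (p + 1) z 0
  rw [Complex.ofReal_one] at h1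
  rw [Complex.ofReal_zero] at h0
  have hfirst : (piece (p + 1) ((0 : ℕ) : ℤ)).eval 0 = 0 := by
    have := piece_eval_one p (-1)
    rw [piece_eq_zero (by norm_num)] at this
    simpa using this.symm
  rw [h0, Finset.sum_range_succ', hfirst, h1, Finset.mul_sum, Finset.sum_range_succ, piece_eval_one,
    piece_eq_zero (i := ((p + 1 : ℕ) : ℤ) + 1) (by omega)]
  simp only [eval_zero, Complex.ofReal_zero, mul_zero, add_zero]
  refine Finset.sum_congr rfl fun i _ => ?_
  rw [piece_eval_one, ← mul_assoc, ← pow_succ']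
  push_cast
  rfl

/-- B-splines form a partition of unity. -/
lemma wave_one (p : ℕ) : wave p 1 = 1 := by
  induction p with
  | zero => exact wave_zero 1
  | succ p ih =>
    have hp : (p + 1 : ℂ[X]) ≠ 0 := by exact_mod_cast Nat.succ_ne_zero p
    apply mul_left_cancel₀ hp
    have hstep : ∀ i : ℕ, (p + 1 : ℂ[X]) * (C (1 ^ i) * (piece (p + 1) i).map (algebraMap ℝ ℂ)) =
        (X + (i : ℂ[X])) * (piece p i).map (algebraMap ℝ ℂ) +
        ((p : ℂ[X]) + 2 - (i : ℂ[X]) - X) * (piece p ((i : ℤ) - 1)).map (algebraMap ℝ ℂ) := by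
      intro i
      have h := congrArg (Polynomial.map (algebraMap ℝ ℂ)) (piece_succ p i)
      simpa [Polynomial.C_ofNat] using h
    rw [wave, Finset.mul_sum, Finset.sum_congr rfl fun i _ => hstep i, Finset.sum_add_distrib,
      sum_piece_extend p fun i => X + (i : ℂ[X]),
      sum_piece_shift p fun i => ((p : ℂ[X]) + 2 - (i : ℂ[X]) - X),
      ← Finset.sum_add_distrib]
    refine Eq.trans ?_ (congrArg (fun f => (p + 1 : ℂ[X]) * f) ih)
    rw [wave, Finset.mul_sum]
    refine Finset.sum_congr rfl fun i _ => ?_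
    rw [one_pow, C_1]
    push_cast
    ring

lemma coeff_wave (p : ℕ) (z : ℂ) : (wave p z).coeff p = (1 - z) ^ p / p.factorial := by
  induction p with
  | zero => simp [wave_zero]
  | succ p ih =>
    have h := congrArg (fun f => f.coeff p) (derivative_wave p z)
    simp only [coeff_derivative, coeff_C_mul, ih] at h
    have h1 : (p + 1 : ℂ) ≠ 0 := by exact_mod_cast Nat.succ_ne_zero p
    have h2 : (p.factorial : ℂ) ≠ 0 := by exact_mod_cast p.factorial_ne_zero
    rw [Nat.factorial_succ]
    push_cast
    rw [eq_div_iff (mul_ne_zero h1 h2), ← mul_assoc, h]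
    field_simp
    ring

/-- The real polynomial `|∑ᵢ zⁱ Fᵢ|²` for a family of real polynomials `Fᵢ`, `0 ≤ i ≤ p`. -/
def normSqSum (p : ℕ) (F : ℤ → ℝ[X]) (z : ℂ) : ℝ[X] :=
  (∑ i ∈ Finset.range (p + 1), C (z ^ i).re * F i) ^ 2 +
    (∑ i ∈ Finset.range (p + 1), C (z ^ i).im * F i) ^ 2

lemma eval_normSqSum (p : ℕ) (F : ℤ → ℝ[X]) (z : ℂ) (t : ℝ) :
    (normSqSum p F z).eval t =
      Complex.normSq (∑ i ∈ Finset.range (p + 1), z ^ i * (((F i).eval t : ℝ) : ℂ)) := by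
  rw [normSqSum, Complex.normSq_apply, Complex.re_sum, Complex.im_sum]
  simp only [eval_add, eval_pow, eval_finsetSum, eval_mul, eval_C, Complex.re_mul_ofReal,
    Complex.im_mul_ofReal]
  ring

lemma eval_normSqSum_piece (p : ℕ) (z : ℂ) (t : ℝ) :
    (normSqSum p (piece p) z).eval t = Complex.normSq ((wave p z).eval (t : ℂ)) := by
  rw [eval_normSqSum, eval_wave]

lemma eval_derivative_wave (p : ℕ) (z : ℂ) (t : ℝ) : (derivative (wave p z)).eval (t : ℂ) =
    ∑ i ∈ Finset.range (p + 1), z ^ i * (((derivative (piece p i)).eval t : ℝ) : ℂ) := by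
  simp only [wave, derivative_sum, derivative_C_mul, derivative_map, eval_finsetSum, eval_mul,
    eval_C, eval_map_ofReal]

lemma normSqSum_derivative_piece (p : ℕ) (z : ℂ) :
    normSqSum (p + 1) (fun i => derivative (piece (p + 1) i)) z =
      Complex.normSq (1 - z) • normSqSum p (piece p) z := by
  refine Polynomial.funext fun t => ?_
  rw [eval_normSqSum, ← eval_derivative_wave, derivative_wave, eval_mul, eval_C, map_mul,
    eval_smul, eval_normSqSum_piece, smul_eq_mul]

lemma natDegree_sum_piece_le (p : ℕ) (c : ℕ → ℝ) :
    (∑ i ∈ Finset.range (p + 1), C (c i) * piece p i).natDegree ≤ p :=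
  natDegree_sum_le_of_forall_le _ _ fun i _ =>
    (natDegree_C_mul_le _ _).trans (natDegree_piece_le p i)

lemma natDegree_normSqSum_piece_le (p : ℕ) (z : ℂ) :
    (normSqSum p (piece p) z).natDegree ≤ 2 * p := by
  exact natDegree_add_le_of_degree_le (natDegree_pow_le_of_le 2 (natDegree_sum_piece_le p _))
    (natDegree_pow_le_of_le 2 (natDegree_sum_piece_le p _))

lemma coeff_normSqSum_piece (p : ℕ) (z : ℂ) :
    (normSqSum p (piece p) z).coeff (2 * p) =
      Complex.normSq (1 - z) ^ p / (p.factorial : ℝ) ^ 2 := by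
  have hre : (∑ i ∈ Finset.range (p + 1), C (z ^ i).re * piece p i).coeff p =
      ((wave p z).coeff p).re := by
    simp [wave, finsetSum_coeff, coeff_C_mul, -map_pow]
  have him : (∑ i ∈ Finset.range (p + 1), C (z ^ i).im * piece p i).coeff p =
      ((wave p z).coeff p).im := by
    simp [wave, finsetSum_coeff, coeff_C_mul, -map_pow]
  have h := natDegree_sum_piece_le p
  rw [normSqSum, coeff_add, sq, sq, two_mul, coeff_mul_add_eq_of_natDegree_le (h _) (h _),
    coeff_mul_add_eq_of_natDegree_le (h _) (h _), hre, him, ← Complex.normSq_apply, coeff_wave,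
    map_div₀, map_pow, Complex.normSq_natCast, sq]

/-! ### Fourier expansion of the symbols -/

lemma hasDerivAt_cexp_neg (ω t : ℝ) :
    HasDerivAt (fun t : ℝ => Complex.exp (-(ω * t * Complex.I)))
      (Complex.exp (-(ω * t * Complex.I)) * -(ω * Complex.I)) t := by
  have h : HasDerivAt (fun t : ℝ => -(ω * (t : ℂ) * Complex.I)) (-(ω * Complex.I)) t := by
    simpa using (((Complex.ofRealCLM.hasDerivAt (x := t)).const_mul (ω : ℂ)).mul_const
      Complex.I).fun_neg
  exact h.cexp

lemma hasDerivAt_eval_ofReal (f : ℂ[X]) (t : ℝ) :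
    HasDerivAt (fun t : ℝ => f.eval (t : ℂ)) ((derivative f).eval (t : ℂ)) t :=
  (f.hasDerivAt (t : ℂ)).comp_ofReal

lemma continuous_eval_ofReal (f : ℂ[X]) : Continuous fun t : ℝ => f.eval (t : ℂ) :=
  f.continuous.comp Complex.continuous_ofReal

lemma continuous_cexp_neg (ω : ℝ) :
    Continuous fun t : ℝ => Complex.exp (-(ω * t * Complex.I)) := by fun_prop

/-- Each integration by parts lowers the degree of the wave by one; its boundary terms cancel by
quasiperiodicity. -/
theorem integral_wave_mul_cexp {ω : ℝ} (hω : ω ≠ 0) {z : ℂ}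
    (hz : Complex.exp (-(ω * Complex.I)) = z) (p : ℕ) :
    ∫ t in (0 : ℝ)..1, (wave p z).eval (t : ℂ) * Complex.exp (-(ω * t * Complex.I)) =
      ((1 - z) / (ω * Complex.I)) ^ (p + 1) := by
  have hωI : (ω * Complex.I : ℂ) ≠ 0 :=
    mul_ne_zero (Complex.ofReal_ne_zero.2 hω) Complex.I_ne_zero
  induction p with
  | zero =>
    have h := intervalIntegral.integral_eq_sub_of_hasDerivAt (a := 0) (b := 1)
      (fun t _ => hasDerivAt_cexp_neg ω t)
      ((((continuous_cexp_neg ω).mul continuous_const)).intervalIntegrable _ _)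
    rw [intervalIntegral.integral_mul_const] at h
    simp only [Complex.ofReal_one, mul_one, Complex.ofReal_zero, mul_zero, zero_mul, neg_zero,
      Complex.exp_zero, hz] at h
    simp only [wave_zero, eval_one, one_mul, zero_add, pow_one]
    rw [eq_div_iff hωI]
    linear_combination -h
  | succ p ih =>
    have hc := continuous_cexp_neg ω
    have h1 : IntervalIntegrable (fun t : ℝ => (derivative (wave (p + 1) z)).eval (t : ℂ) *
        Complex.exp (-(ω * t * Complex.I))) MeasureTheory.volume 0 1 :=
      ((continuous_eval_ofReal _).mul hc).intervalIntegrable _ _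
    have h2 : IntervalIntegrable (fun t : ℝ => (wave (p + 1) z).eval (t : ℂ) *
        (Complex.exp (-(ω * t * Complex.I)) * -(ω * Complex.I))) MeasureTheory.volume 0 1 :=
      ((continuous_eval_ofReal _).mul (hc.mul continuous_const)).intervalIntegrable _ _
    have h := intervalIntegral.integral_eq_sub_of_hasDerivAt (a := 0) (b := 1)
      (fun t _ => (hasDerivAt_eval_ofReal (wave (p + 1) z) t).fun_mul (hasDerivAt_cexp_neg ω t))
      (h1.add h2)
    rw [intervalIntegral.integral_add h1 h2] at h
    simp only [derivative_wave, eval_mul, eval_C, mul_assoc (1 - z),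
      intervalIntegral.integral_const_mul, ← mul_assoc _ _ (-(ω * Complex.I : ℂ)),
      intervalIntegral.integral_mul_const, Complex.ofReal_one, mul_one, Complex.ofReal_zero,
      mul_zero, zero_mul, neg_zero, Complex.exp_zero, hz] at h
    rw [ih] at h
    have hq := wave_eval_one p z
    rw [pow_succ, ← mul_div_assoc, eq_div_iff hωI]
    linear_combination -h - hq

/-- Parseval's identity for the wave. -/
theorem hasSum_unitIntegral_wave (p : ℕ) {θ : ℝ} (hθ : ∀ n : ℤ, θ + 2 * Real.pi * n ≠ 0) {z : ℂ}
    (hz : Complex.exp (-(θ * Complex.I)) = z) :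
    HasSum (fun n : ℤ => (Complex.normSq (1 - z) / (θ + 2 * Real.pi * n) ^ 2) ^ (p + 1))
      (unitIntegral (normSqSum p (piece p) z)) := by
  set f : ℝ → ℂ := fun t => (wave p z).eval (t : ℂ) * Complex.exp (-(θ * t * Complex.I)) with hf
  have hfc : Continuous f := (continuous_eval_ofReal _).mul (continuous_cexp_neg θ)
  have hL2 : MeasureTheory.MemLp f 2 (MeasureTheory.volume.restrict (Set.Ioc 0 1)) := by
    obtain ⟨B, hB⟩ := isCompact_Icc.exists_bound_of_continuousOn
      (hfc.continuousOn (s := Set.Icc (0 : ℝ) 1))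
    refine MeasureTheory.MemLp.of_bound hfc.aestronglyMeasurable B ?_
    filter_upwards [MeasureTheory.ae_restrict_mem measurableSet_Ioc] with t ht
    exact hB t (Set.Ioc_subset_Icc_self ht)
  have h := hasSum_sq_fourierCoeffOn zero_lt_one hL2
  have hnorm : ∀ t : ℝ, ‖f t‖ ^ 2 = (normSqSum p (piece p) z).eval t := by
    intro t
    rw [eval_normSqSum_piece, hf, norm_mul, Complex.normSq_eq_norm_sq]
    have : ‖Complex.exp (-(θ * t * Complex.I))‖ = 1 := by
      have := Complex.norm_exp_ofReal_mul_I (-(θ * t))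
      rwa [show ((-(θ * t) : ℝ) : ℂ) * Complex.I = -(θ * t * Complex.I) by push_cast; ring] at this
    rw [this, mul_one]
  have hcoeff : ∀ n : ℤ, ‖fourierCoeffOn zero_lt_one f n‖ ^ 2 =
      (Complex.normSq (1 - z) / (θ + 2 * Real.pi * n) ^ 2) ^ (p + 1) := by
    intro n
    have hzn : Complex.exp (-((θ + 2 * Real.pi * n : ℝ) * Complex.I)) = z := by
      rw [← hz, Complex.exp_eq_exp_iff_exists_int]
      exact ⟨-n, by push_cast; ring⟩
    have hint : fourierCoeffOn zero_lt_one f n = ((1 - z) /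
        ((θ + 2 * Real.pi * n : ℝ) * Complex.I)) ^ (p + 1) := by
      rw [← integral_wave_mul_cexp (hθ n) hzn, fourierCoeffOn_eq_integral]
      simp only [sub_zero, div_one, one_smul]
      refine intervalIntegral.integral_congr fun t _ => ?_
      simp only [smul_eq_mul, hf]
      rw [fourier_coe_apply, mul_left_comm, ← Complex.exp_add]
      congr 2
      push_cast
      ring
    rw [hint, norm_pow, norm_div, norm_mul, Complex.norm_I, mul_one, Complex.norm_real,
      Complex.normSq_eq_norm_sq, ← pow_mul, mul_comm (p + 1), pow_mul, div_pow, Real.norm_eq_abs,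
      sq_abs]
  simp only [hcoeff, sub_zero, inv_one, one_smul, hnorm] at h
  exact h

/-! ### The one-dimensional dispersion error -/

lemma hasSum_bernoulliRatio {p : ℕ} (hp : 1 ≤ p) :
    HasSum (fun n : ℤ => 1 / (2 * Real.pi * n) ^ (2 * p)) (bernoulliRatio p) := by
  have hpi : Real.pi ≠ 0 := Real.pi_ne_zero
  have h := (hasSum_zeta_nat (k := p) (by omega)).mul_left (1 / (2 * Real.pi) ^ (2 * p))
  have hpos : HasSum (fun n : ℕ => 1 / (2 * Real.pi * ((n : ℤ) : ℝ)) ^ (2 * p))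
      (bernoulliRatio p / 2) := by
    have h2 : (2 : ℝ) ^ (2 * p) = 2 * 2 ^ (2 * p - 1) := by
      rw [← pow_succ']; congr 1; omega
    have hval : bernoulliRatio p / 2 = 1 / (2 * Real.pi) ^ (2 * p) *
        ((-1) ^ (p + 1) * 2 ^ (2 * p - 1) * Real.pi ^ (2 * p) *
          _root_.bernoulli (2 * p) / (2 * p).factorial) := by
      rw [bernoulliRatio, mul_pow, h2]
      field_simp
    rw [hval]
    refine h.congr_fun fun n => ?_
    rw [Int.cast_natCast, mul_pow _ (n : ℝ), one_div_mul_one_div]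
  have hneg : HasSum (fun n : ℕ => 1 / (2 * Real.pi * ((-(n : ℤ) : ℤ) : ℝ)) ^ (2 * p))
      (bernoulliRatio p / 2) := by
    refine hpos.congr_fun fun n => ?_
    rw [Int.cast_neg, mul_neg, (even_two_mul p).neg_pow]
  have h0 : 2 * p ≠ 0 := by omega
  have hsum := HasSum.of_nat_of_neg (f := fun n : ℤ => 1 / (2 * Real.pi * n) ^ (2 * p)) hpos hneg
  simpa [h0] using hsum

lemma hasSum_inv_odd_pow {p : ℕ} (hp : 1 ≤ p) :
    HasSum (fun n : ℤ => 1 / (2 * Real.pi * n) ^ (2 * p + 1)) 0 := by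
  have hs : Summable (fun n : ℤ => 1 / (2 * Real.pi * n) ^ (2 * p + 1)) := by
    have := (Real.summable_one_div_int_pow (p := 2 * p + 1)).2 (by omega)
    refine (summable_congr fun n => ?_).2 (this.mul_left (1 / (2 * Real.pi) ^ (2 * p + 1)))
    rw [mul_pow _ (n : ℝ), one_div_mul_one_div]
  have hodd : HasSum (fun n : ℤ => 1 / (2 * Real.pi * n) ^ (2 * p + 1))
      (-∑' n : ℤ, 1 / (2 * Real.pi * n) ^ (2 * p + 1)) := by
    have h := ((Equiv.neg ℤ).hasSum_iff.2 hs.hasSum).neg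
    refine h.congr_fun fun n => ?_
    simp only [Function.comp_apply, Equiv.neg_apply, Int.cast_neg, mul_neg]
    rw [(odd_two_mul_add_one p).neg_pow, div_neg, neg_neg]
  have h0 : ∑' n : ℤ, 1 / (2 * Real.pi * n) ^ (2 * p + 1) = 0 := by
    have := hs.hasSum.unique hodd
    linarith
  rw [h0, neg_zero] at hodd
  exact hodd

lemma exists_inv_one_add_pow_bound (m : ℕ) : ∃ C : ℝ, 0 ≤ C ∧
    ∀ u : ℝ, |u| ≤ 1 / 2 → |((1 + u)⁻¹) ^ m - 1 + m * u| ≤ C * u ^ 2 := by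
  induction m with
  | zero => exact ⟨0, le_rfl, fun u _ => by simp⟩
  | succ m ih =>
    obtain ⟨C, hC, h⟩ := ih
    refine ⟨2 * C + 2 * (1 + m) + m, by positivity, fun u hu => ?_⟩
    have hu' := abs_le.1 hu
    have hpos : 0 < 1 + u := by linarith
    have hv : (1 + u)⁻¹ ≤ 2 := by
      rw [inv_le_comm₀ hpos two_pos]; linarith
    have hv0 : 0 < (1 + u)⁻¹ := inv_pos.2 hpos
    have hv1 : (1 + u)⁻¹ - 1 + u = u ^ 2 * (1 + u)⁻¹ := by field_simp; ring
    have hsplit : ((1 + u)⁻¹) ^ (m + 1) - 1 + ((m + 1 : ℕ) : ℝ) * u =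
        (((1 + u)⁻¹) ^ m - 1 + m * u) * (1 + u)⁻¹ +
          ((1 - m * u) * (u ^ 2 * (1 + u)⁻¹) + m * u ^ 2) := by
      rw [← hv1]; push_cast; ring
    have h1 : |(((1 + u)⁻¹) ^ m - 1 + m * u) * (1 + u)⁻¹| ≤ C * u ^ 2 * 2 := by
      rw [abs_mul, abs_of_pos hv0]
      exact mul_le_mul (h u hu) hv hv0.le (by positivity)
    have h2 : |(1 - m * u) * (u ^ 2 * (1 + u)⁻¹)| ≤ (1 + m) * (u ^ 2 * 2) := by
      rw [abs_mul, abs_of_nonneg (show 0 ≤ u ^ 2 * (1 + u)⁻¹ by positivity)]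
      refine mul_le_mul ?_ (by gcongr) (by positivity) (by positivity)
      refine (abs_sub _ _).trans ?_
      rw [abs_one, abs_mul, Nat.abs_cast]
      have : (m : ℝ) * |u| ≤ m * 1 := by gcongr; linarith
      linarith
    have h3 : |(m : ℝ) * u ^ 2| ≤ m * u ^ 2 := (abs_of_nonneg (by positivity)).le
    rw [hsplit]
    refine (abs_add_le _ _).trans ?_
    refine (add_le_add h1 ((abs_add_le _ _).trans (add_le_add h2 h3))).trans (le_of_eq ?_)
    ring

/-- The contribution of an aliased frequency `θ + 2πn` to the dispersion error, to second order in
`θ`.  All terms vanish at `n = 0`, by the convention `1 / 0 = 0`. -/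
lemma exists_alias_bound {p : ℕ} (hp : 1 ≤ p) : ∃ C : ℝ, 0 ≤ C ∧ ∀ θ : ℝ, |θ| ≤ 1 → ∀ n : ℤ,
    |((θ + 2 * Real.pi * n) ^ 2 - θ ^ 2) / (θ + 2 * Real.pi * n) ^ (2 * p + 2) -
        1 / (2 * Real.pi * n) ^ (2 * p) +
        2 * p * θ * (1 / (2 * Real.pi * n) ^ (2 * p + 1))| ≤ C * θ ^ 2 * (1 / (n : ℝ) ^ 2) := by
  obtain ⟨C, hC, hbound⟩ := exists_inv_one_add_pow_bound (2 * p)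
  refine ⟨C + 1, by positivity, fun θ hθ n => ?_⟩
  rcases eq_or_ne n 0 with rfl | hn
  · have : 2 * p ≠ 0 := by omega
    simp [this]
  have hn1 : (1 : ℝ) ≤ |(n : ℝ)| := by exact_mod_cast Int.one_le_abs hn
  have hn0 : (n : ℝ) ≠ 0 := by exact_mod_cast hn
  set x : ℝ := 2 * Real.pi * n with hx
  have hxabs : |x| = 2 * Real.pi * |(n : ℝ)| := by
    rw [hx, abs_mul, abs_of_pos (by positivity)]
  have hx3 : 6 * |(n : ℝ)| ≤ |x| := by
    rw [hxabs]; have := Real.pi_gt_three; gcongr; linarith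
  have hx0 : x ≠ 0 := abs_pos.1 (by linarith)
  have hu : |θ / x| ≤ 1 / 2 := by
    rw [abs_div, div_le_iff₀ (by linarith)]; linarith
  have hω : |(n : ℝ)| ≤ |θ + x| := by
    have := abs_sub_abs_le_abs_sub x (-θ)
    rw [abs_neg, sub_neg_eq_add, add_comm x] at this
    linarith
  have hω0 : θ + x ≠ 0 := abs_pos.1 (by linarith)
  have h1u : 1 + θ / x ≠ 0 := by
    have := (abs_le.1 hu).1
    intro h; linarith
  have hsplit : ((θ + x) ^ 2 - θ ^ 2) / (θ + x) ^ (2 * p + 2) - 1 / x ^ (2 * p) +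
      2 * p * θ * (1 / x ^ (2 * p + 1)) =
      (((1 + θ / x)⁻¹) ^ (2 * p) - 1 + ((2 * p : ℕ) : ℝ) * (θ / x)) / x ^ (2 * p) -
        θ ^ 2 / (θ + x) ^ (2 * p + 2) := by
    have e1 : ((1 + θ / x)⁻¹) ^ (2 * p) / x ^ (2 * p) = 1 / (θ + x) ^ (2 * p) := by
      rw [inv_pow, ← one_div, div_div, ← mul_pow, add_mul, div_mul_cancel₀ _ hx0, one_mul, add_comm]
    have e2 : ((θ + x) ^ 2 - θ ^ 2) / (θ + x) ^ (2 * p + 2) =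
        1 / (θ + x) ^ (2 * p) - θ ^ 2 / (θ + x) ^ (2 * p + 2) := by
      rw [sub_div]
      congr 1
      rw [pow_add, div_mul_cancel_right₀ (pow_ne_zero 2 hω0), one_div]
    rw [e2, add_div, sub_div, e1]
    push_cast
    field_simp
    ring
  have hpow1 : 1 ≤ |x| ^ (2 * p) := one_le_pow₀ (by linarith)
  have hnx : |(n : ℝ)| ≤ |x| := by linarith
  have b1 : |(((1 + θ / x)⁻¹) ^ (2 * p) - 1 + ((2 * p : ℕ) : ℝ) * (θ / x)) / x ^ (2 * p)| ≤
      C * θ ^ 2 * (1 / (n : ℝ) ^ 2) := by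
    rw [abs_div, abs_pow]
    refine (div_le_self (abs_nonneg _) hpow1).trans ((hbound _ hu).trans ?_)
    rw [div_pow, mul_assoc, div_eq_mul_one_div, ← sq_abs x, ← sq_abs (n : ℝ)]
    gcongr
  have b2 : |θ ^ 2 / (θ + x) ^ (2 * p + 2)| ≤ 1 * θ ^ 2 * (1 / (n : ℝ) ^ 2) := by
    rw [abs_div, abs_pow, abs_pow, sq_abs, one_mul, div_eq_mul_one_div, ← sq_abs (n : ℝ)]
    gcongr
    calc |(n : ℝ)| ^ 2 ≤ |(n : ℝ)| ^ (2 * p + 2) := pow_le_pow_right₀ hn1 (by omega)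
      _ ≤ |θ + x| ^ (2 * p + 2) := by gcongr
  rw [hsplit]
  refine (abs_sub _ _).trans ((add_le_add b1 b2).trans (le_of_eq ?_))
  ring

lemma normSq_one_sub_cexp (θ : ℝ) :
    Complex.normSq (1 - Complex.exp (-(θ * Complex.I))) = 2 - 2 * Real.cos θ := by
  have h : -(θ * Complex.I : ℂ) = ((-θ : ℝ) : ℂ) * Complex.I := by push_cast; ring
  rw [h, Complex.normSq_apply]
  simp only [Complex.sub_re, Complex.sub_im, Complex.one_re, Complex.one_im,
    Complex.exp_ofReal_mul_I_re, Complex.exp_ofReal_mul_I_im, Real.cos_neg, Real.sin_neg]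
  nlinarith [Real.sin_sq_add_cos_sq θ]

/-- The symbol of the mass matrix for the optimally blended rules. -/
def massSymbol (p : ℕ) (θ : ℝ) : ℝ :=
  unitIntegral (normSqSum p (piece p) (Complex.exp (-(θ * Complex.I)))) +
    (2 - 2 * Real.cos θ) ^ p * bernoulliRatio p

/-- The symbol of the stiffness matrix for splines of degree `p + 1`. -/
def stiffSymbol (p : ℕ) (θ : ℝ) : ℝ :=
  (2 - 2 * Real.cos θ) * unitIntegral (normSqSum p (piece p) (Complex.exp (-(θ * Complex.I))))

/-- The dispersion error of the optimally blended rules in one dimension. -/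
theorem exists_dispersion_bound (p : ℕ) : ∃ C : ℝ, 0 ≤ C ∧ ∀ θ : ℝ, |θ| ≤ 1 →
    0 < massSymbol (p + 1) θ ∧
    |stiffSymbol p θ / massSymbol (p + 1) θ - θ ^ 2| ≤ C * (θ ^ 2) ^ (p + 3) := by
  obtain ⟨C, hC, halias⟩ := exists_alias_bound (p := p + 1) (by omega)
  have hZ := ((Real.summable_one_div_int_pow (p := 2)).2 one_lt_two).hasSum
  set Z : ℝ := ∑' n : ℤ, 1 / (n : ℝ) ^ 2
  have hZ0 : 0 ≤ Z := tsum_nonneg fun n => by positivity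
  set β := bernoulliRatio (p + 1)
  have hβ := hasSum_bernoulliRatio (p := p + 1) (by omega)
  have hβ0 : 0 ≤ β := hβ.nonneg fun n => by
    rw [pow_mul]; positivity
  refine ⟨2 ^ (p + 2) * (C * Z + β), by positivity, fun θ hθ => ?_⟩
  rcases eq_or_ne θ 0 with rfl | hθ0
  · have h1 : normSqSum (p + 1) (piece (p + 1)) 1 = 1 := Polynomial.funext fun t => by
      rw [eval_normSqSum_piece, wave_one]; simp
    simp [massSymbol, stiffSymbol, h1, unitIntegral_apply]
  have hθsq : 0 < θ ^ 2 := by positivity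
  have hθ1 : θ ^ 2 ≤ 1 := by rw [← sq_abs]; exact pow_le_one₀ (abs_nonneg _) hθ
  set z := Complex.exp (-(θ * Complex.I)) with hz
  set s := 2 - 2 * Real.cos θ with hs
  have hnorm : Complex.normSq (1 - z) = s := normSq_one_sub_cexp θ
  have hcos := abs_le.1 (Real.cos_bound hθ)
  have hs4 : |θ| ^ 4 = (θ ^ 2) ^ 2 := by
    rw [← sq_abs θ]; ring
  rw [hs4] at hcos
  have hs1 : s ≤ θ ^ 2 := by have := Real.one_sub_sq_div_two_le_cos (x := θ); linarith
  have hs2 : θ ^ 2 - s ≤ (θ ^ 2) ^ 2 := by nlinarith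
  have hs3 : θ ^ 2 / 2 ≤ s := by nlinarith
  have hs0 : 0 < s := by linarith
  have hω : ∀ n : ℤ, θ + 2 * Real.pi * n ≠ 0 := by
    intro n hn
    rcases eq_or_ne n 0 with rfl | hn0
    · simp at hn; exact hθ0 hn
    · have h1 : (1 : ℝ) ≤ |(n : ℝ)| := by exact_mod_cast Int.one_le_abs hn0
      have h2 : |θ| = 2 * Real.pi * |(n : ℝ)| := by
        rw [eq_neg_of_add_eq_zero_left hn, abs_neg, abs_mul,
          abs_of_pos (show 0 < 2 * Real.pi by positivity)]
      nlinarith [Real.pi_gt_three]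
  have hE0 := hasSum_unitIntegral_wave p hω hz.symm
  have hE1 := hasSum_unitIntegral_wave (p + 1) hω hz.symm
  rw [hnorm] at hE0 hE1
  set E0 := unitIntegral (normSqSum p (piece p) z)
  set E1 := unitIntegral (normSqSum (p + 1) (piece (p + 1)) z)
  have hM : massSymbol (p + 1) θ = E1 + s ^ (p + 1) * β := rfl
  have hK : stiffSymbol p θ = s * E0 := rfl
  have hMlow : (1 / 2 : ℝ) ^ (p + 2) ≤ massSymbol (p + 1) θ := by
    have h := le_hasSum hE1 0 fun n _ => by positivity
    simp only [Int.cast_zero, mul_zero, add_zero] at h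
    have h2 : (1 / 2 : ℝ) ^ (p + 2) ≤ (s / θ ^ 2) ^ (p + 2) := by
      refine pow_le_pow_left₀ (by norm_num) ?_ _
      rw [le_div_iff₀ hθsq]; linarith
    have h3 : 0 ≤ s ^ (p + 1) * β := by positivity
    rw [hM]; linarith
  have hMpos : 0 < massSymbol (p + 1) θ := lt_of_lt_of_le (by positivity) hMlow
  refine ⟨hMpos, ?_⟩
  set τ := (s * E0 - θ ^ 2 * E1) / s ^ (p + 2) with hτ
  have hτsum : HasSum (fun n : ℤ => ((θ + 2 * Real.pi * n) ^ 2 - θ ^ 2) /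
      (θ + 2 * Real.pi * n) ^ (2 * (p + 1) + 2)) τ := by
    refine (((hE0.mul_left s).sub (hE1.mul_left (θ ^ 2))).div_const (s ^ (p + 2))).congr_fun
      fun n => ?_
    have := hω n
    set ω := θ + 2 * Real.pi * n
    rw [div_pow, div_pow, ← pow_mul, ← pow_mul]
    field_simp
    ring
  have hτβ : |τ - β| ≤ C * θ ^ 2 * Z := by
    have h := (hτsum.sub hβ).add
      ((hasSum_inv_odd_pow (p := p + 1) (by omega)).mul_left (2 * ((p + 1 : ℕ) : ℝ) * θ))
    rw [mul_zero, add_zero] at h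
    exact h.norm_le_of_bounded (hZ.mul_left (C * θ ^ 2)) fun n => halias θ hθ n
  have hD : |s * E0 - θ ^ 2 * massSymbol (p + 1) θ| ≤ (C * Z + β) * (θ ^ 2) ^ (p + 3) := by
    have e : s * E0 - θ ^ 2 * massSymbol (p + 1) θ =
        s ^ (p + 1) * (s * (τ - β) - (θ ^ 2 - s) * β) := by
      have hτ' : s ^ (p + 2) * τ = s * E0 - θ ^ 2 * E1 := by
        rw [hτ]; field_simp
      rw [hM]
      linear_combination -hτ'
    rw [e, abs_mul, abs_of_pos (pow_pos hs0 _)]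
    have h1 : |s * (τ - β) - (θ ^ 2 - s) * β| ≤
        θ ^ 2 * (C * θ ^ 2 * Z) + (θ ^ 2) ^ 2 * β := by
      refine (abs_sub _ _).trans (add_le_add ?_ ?_)
      · rw [abs_mul, abs_of_pos hs0]
        gcongr
      · rw [abs_mul, abs_of_nonneg hβ0, abs_of_nonneg (by linarith)]
        gcongr
    calc s ^ (p + 1) * |s * (τ - β) - (θ ^ 2 - s) * β|
        ≤ (θ ^ 2) ^ (p + 1) * (θ ^ 2 * (C * θ ^ 2 * Z) + (θ ^ 2) ^ 2 * β) := by gcongr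
      _ = (C * Z + β) * (θ ^ 2) ^ (p + 3) := by ring
  have hdiv : stiffSymbol p θ / massSymbol (p + 1) θ - θ ^ 2 =
      (s * E0 - θ ^ 2 * massSymbol (p + 1) θ) / massSymbol (p + 1) θ := by
    rw [hK]; field_simp
  rw [hdiv, abs_div, abs_of_pos hMpos, div_le_iff₀ hMpos]
  refine hD.trans ?_
  have h2 : (1 : ℝ) ≤ 2 ^ (p + 2) * massSymbol (p + 1) θ := by
    calc (1 : ℝ) = 2 ^ (p + 2) * (1 / 2) ^ (p + 2) := by rw [← mul_pow]; norm_num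
      _ ≤ _ := by gcongr
  calc (C * Z + β) * (θ ^ 2) ^ (p + 3) = (C * Z + β) * (θ ^ 2) ^ (p + 3) * 1 := by ring
    _ ≤ (C * Z + β) * (θ ^ 2) ^ (p + 3) * (2 ^ (p + 2) * massSymbol (p + 1) θ) := by gcongr
    _ = _ := by ring

/-! ### Tensor product structure -/

lemma hasSum_pi_prod {d : ℕ} {R : Type*} [CommSemiring R] [TopologicalSpace R]
    (f : Fin d → ℤ → R) (s : Finset ℤ) (hf : ∀ k n, n ∉ s → f k n = 0) :
    HasSum (fun c : Fin d → ℤ => ∏ k, f k (c k)) (∏ k, ∑ n ∈ s, f k n) := by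
  rw [Finset.prod_univ_sum]
  refine hasSum_sum_of_ne_finset_zero fun c hc => ?_
  obtain ⟨k, hk⟩ : ∃ k, c k ∉ s := by simpa [Fintype.mem_piFinset] using hc
  exact Finset.prod_eq_zero (Finset.mem_univ k) (hf k _ hk)

/-- The one-dimensional bilinear form, with quadrature `Q`, of two splines on the unit mesh with
polynomial pieces `Fᵢ`, `0 ≤ i ≤ p`, and indices `a` and `0`. -/
def form1 (Q : Rule) (p : ℕ) (F : ℤ → ℝ[X]) (a : ℤ) : ℝ :=
  ∑ c ∈ Finset.Icc (0 : ℤ) p, quad Q (F (c - a) * F c)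

lemma quad_zero (Q : Rule) : quad Q 0 = 0 := by simp [quad]

lemma form1_eq_zero {Q : Rule} {p : ℕ} {F : ℤ → ℝ[X]} (hF : ∀ i, i ∉ Finset.Icc (0 : ℤ) p → F i = 0)
    {a : ℤ} (ha : a ∉ Finset.Icc (-p : ℤ) p) : form1 Q p F a = 0 := by
  refine Finset.sum_eq_zero fun c hc => ?_
  rw [hF (c - a), zero_mul, quad_zero]
  simp only [Finset.mem_Icc] at *
  omega

lemma sum_Icc_eq_sum_range {R : Type*} [AddCommMonoid R] (p : ℕ) (f : ℤ → R) :
    ∑ i ∈ Finset.Icc (0 : ℤ) p, f i = ∑ i ∈ Finset.range (p + 1), f i := by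
  symm
  refine Finset.sum_nbij (fun i : ℕ => (i : ℤ)) ?_ ?_ ?_ fun _ _ => rfl
  · intro i hi
    simp only [Finset.mem_range, Finset.mem_Icc] at *
    omega
  · exact fun i _ j _ hij => by simpa using hij
  · intro i hi
    simp only [Finset.coe_Icc, Set.mem_Icc] at hi
    exact ⟨i.toNat, by simp only [Finset.coe_range, Set.mem_Iio]; omega, by simp [hi.1]⟩

/-- The form of the wave and a basis function, rearranged over the indices of the wave, is
the value of `Q` at the squared modulus of the wave on one cell. -/
lemma sum_wave_form1 (Q : Rule) (p : ℕ) {F : ℤ → ℝ[X]}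
    (hF : ∀ i, i ∉ Finset.Icc (0 : ℤ) p → F i = 0) (θ : ℝ) :
    ∑ a ∈ Finset.Icc (-p : ℤ) p, Complex.exp (a * θ * Complex.I) * (form1 Q p F a : ℂ) =
      (quad Q (normSqSum p F (Complex.exp (-(θ * Complex.I)))) : ℂ) := by
  set z := Complex.exp (-(θ * Complex.I)) with hz
  have hexp : ∀ a : ℤ, Complex.exp (a * θ * Complex.I) = z ^ (-a) := by
    intro a
    rw [hz, ← Complex.exp_int_mul]
    congr 1
    push_cast
    ring
  have hz0 : z ≠ 0 := Complex.exp_ne_zero _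
  have hconj : (starRingEnd ℂ) z = z⁻¹ := by
    rw [hz, ← Complex.exp_conj, ← Complex.exp_neg]
    simp
  -- The substitution `i = c - a` in the inner sum.
  have hshift : ∀ c ∈ Finset.Icc (0 : ℤ) p, ∀ x : ℝ,
      ∑ a ∈ Finset.Icc (-p : ℤ) p, z ^ (-a) * (((F (c - a)).eval x : ℝ) : ℂ) =
        z ^ (-c) * ∑ i ∈ Finset.Icc (0 : ℤ) p, z ^ i * (((F i).eval x : ℝ) : ℂ) := by
    intro c hc x
    have h1 : ∑ i ∈ Finset.Icc (0 : ℤ) p, z ^ i * (((F i).eval x : ℝ) : ℂ) =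
        ∑' i : ℤ, z ^ i * (((F i).eval x : ℝ) : ℂ) := by
      symm
      exact tsum_eq_sum fun i hi => by simp [hF i hi]
    rw [h1, ← (Equiv.subLeft c).tsum_eq, ← tsum_mul_left]
    symm
    rw [tsum_eq_sum (s := Finset.Icc (-p : ℤ) p)]
    · refine Finset.sum_congr rfl fun a _ => ?_
      rw [Equiv.subLeft_apply, ← mul_assoc, ← zpow_add₀ hz0]
      congr 2
      ring
    · intro a ha
      rw [Equiv.subLeft_apply, hF (c - a)]
      · simp
      · simp only [Finset.mem_Icc] at *
        omega
  have hleft : ∑ a ∈ Finset.Icc (-p : ℤ) p, Complex.exp (a * θ * Complex.I) *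
      (form1 Q p F a : ℂ) = ∑ x ∈ Q.support, (Q x : ℂ) *
        ((∑ c ∈ Finset.Icc (0 : ℤ) p, z ^ (-c) * (((F c).eval x : ℝ) : ℂ)) *
          ∑ i ∈ Finset.Icc (0 : ℤ) p, z ^ i * (((F i).eval x : ℝ) : ℂ)) := by
    simp only [hexp, form1, quad, eval_mul, Complex.ofReal_sum, Complex.ofReal_mul, Finset.mul_sum]
    rw [Finset.sum_comm, Finset.sum_congr rfl fun c _ => Finset.sum_comm, Finset.sum_comm]
    refine Finset.sum_congr rfl fun x _ => ?_
    rw [← Finset.mul_sum, ← Finset.mul_sum, Finset.sum_mul, Finset.mul_sum]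
    refine Finset.sum_congr rfl fun c hc => ?_
    rw [mul_right_comm, ← hshift c hc x, Finset.sum_mul, Finset.mul_sum]
    exact Finset.sum_congr rfl fun a _ => by ring
  rw [hleft, quad, Complex.ofReal_sum]
  refine Finset.sum_congr rfl fun x _ => ?_
  rw [eval_normSqSum, Complex.ofReal_mul, Complex.normSq_eq_conj_mul_self, map_sum,
    sum_Icc_eq_sum_range, sum_Icc_eq_sum_range]
  simp only [map_mul, map_pow, hconj, Complex.conj_ofReal, zpow_neg, zpow_natCast, inv_pow]

lemma waveCoeff_eq_prod {d : ℕ} (h κ : Fin d → ℝ) (a : Fin d → ℤ) :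
    waveCoeff h κ a = ∏ k, Complex.exp (a k * ((κ k * h k : ℝ) : ℂ) * Complex.I) := by
  rw [waveCoeff, ← Complex.exp_sum]
  congr 1
  push_cast
  rw [Finset.mul_sum]
  exact Finset.sum_congr rfl fun k _ => by ring

/-- The forms of the discrete wave are products of one-dimensional symbols. -/
lemma hasSum_waveCoeff_mul_prod_form1 {d : ℕ} (Q : Rule) (p : ℕ) (F : Fin d → ℤ → ℝ[X])
    (hF : ∀ l i, i ∉ Finset.Icc (0 : ℤ) p → F l i = 0) (h κ : Fin d → ℝ) :
    HasSum (fun a : Fin d → ℤ => waveCoeff h κ a * ((∏ l, form1 Q p (F l) (a l) : ℝ) : ℂ))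
      ((∏ l, quad Q (normSqSum p (F l) (Complex.exp (-((κ l * h l : ℝ) * Complex.I)))) : ℝ) :
        ℂ) := by
  have hs := hasSum_pi_prod (R := ℂ) (fun l (n : ℤ) =>
    Complex.exp (n * ((κ l * h l : ℝ) : ℂ) * Complex.I) * (form1 Q p (F l) n : ℂ))
    (Finset.Icc (-p : ℤ) p) (fun l n hn => by
      rw [form1_eq_zero (hF l) hn, Complex.ofReal_zero, mul_zero])
  simp only [sum_wave_form1 Q p (hF _)] at hs
  rw [Complex.ofReal_prod]
  refine hs.congr_fun fun a => ?_
  rw [waveCoeff_eq_prod, Complex.ofReal_prod, Finset.prod_mul_distrib]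

lemma sum_piFinset_quad {d : ℕ} (Q : Rule) (F G : Fin d → ℝ[X]) :
    ∑ t ∈ Fintype.piFinset (fun _ : Fin d => Q.support),
      (∏ k, Q (t k)) * ((∏ l, (F l).eval (t l)) * ∏ l, (G l).eval (t l)) =
      ∏ l, quad Q (F l * G l) := by
  simp only [quad, Finset.prod_univ_sum, eval_mul, Finset.prod_mul_distrib]

lemma hasSum_prod_quad {d : ℕ} (Q : Rule) (p : ℕ) (F : Fin d → ℤ → ℝ[X])
    (hF : ∀ l i, i ∉ Finset.Icc (0 : ℤ) p → F l i = 0) (a : Fin d → ℤ) :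
    HasSum (fun c : Fin d → ℤ => ∏ l, quad Q (F l (c l - a l) * F l (c l)))
      (∏ l, form1 Q p (F l) (a l)) :=
  hasSum_pi_prod (fun l c => quad Q (F l (c - a l) * F l c)) (Finset.Icc (0 : ℤ) p)
    fun l c hc => by rw [hF l c hc, mul_zero, quad_zero]

/-! ### The forms on tensor product B-splines -/

lemma piece_eq_zero_of_notMem (p : ℕ) (i : ℤ) (hi : i ∉ Finset.Icc (0 : ℤ) p) : piece p i = 0 :=
  piece_eq_zero (by rw [Finset.mem_Icc] at hi; omega)

lemma basisFun_cellPoint {d : ℕ} {h : Fin d → ℝ} (hh : ∀ k, 0 < h k) {p : ℕ} (hp : 1 ≤ p)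
    (a c : Fin d → ℤ) {t : Fin d → ℝ} (ht : ∀ k, t k ∈ Set.Icc (0 : ℝ) 1) :
    basisFun p h a (cellPoint h c t) = ∏ l, (piece p (c l - a l)).eval (t l) :=
  Finset.prod_congr rfl fun l _ => bspline_eq_piece (hh l) hp (a l) (c l) (ht l)

/-- The one-dimensional factors of the partial derivative in direction `k` of a tensor product
spline. -/
def gradPiece {d : ℕ} (p : ℕ) (k l : Fin d) (i : ℤ) : ℝ[X] :=
  if l = k then derivative (piece p i) else piece p i

lemma gradPiece_eq_zero {d : ℕ} (p : ℕ) (k l : Fin d) (i : ℤ) (hi : i ∉ Finset.Icc (0 : ℤ) p) :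
    gradPiece p k l i = 0 := by
  simp [gradPiece, piece_eq_zero_of_notMem p i hi]

lemma cellPartial_basisFun {d : ℕ} {h : Fin d → ℝ} (hh : ∀ k, 0 < h k) {p : ℕ} (hp : 1 ≤ p)
    (a c : Fin d → ℤ) (k : Fin d) {t : Fin d → ℝ} (ht : ∀ k, t k ∈ Set.Icc (0 : ℝ) 1) :
    cellPartial h c k (basisFun p h a) (cellPoint h c t) =
      (h k)⁻¹ * ∏ l, (gradPiece p k l (c l - a l)).eval (t l) := by
  have hhk := hh k
  set R : ℝ := ∏ l ∈ Finset.univ.erase k, (piece p (c l - a l)).eval (t l) with hR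
  set g : ℝ → ℝ := fun s => (piece p (c k - a k)).eval (s * (h k)⁻¹ - c k) * R with hg
  have hx : cellPoint h c t k ∈ Set.Icc (c k * h k) ((c k + 1) * h k) := by
    have := ht k
    constructor
    · simp only [cellPoint]; nlinarith [this.1]
    · simp only [cellPoint]; nlinarith [this.2]
  have hEq : Set.EqOn (fun s => basisFun p h a (Function.update (cellPoint h c t) k s)) g
      (Set.Icc (c k * h k) ((c k + 1) * h k)) := by
    intro s hs
    have hs' : s * (h k)⁻¹ - c k ∈ Set.Icc (0 : ℝ) 1 := by
      have h1 : c k * h k * (h k)⁻¹ ≤ s * (h k)⁻¹ :=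
        mul_le_mul_of_nonneg_right hs.1 (inv_nonneg.2 hhk.le)
      have h2 : s * (h k)⁻¹ ≤ (c k + 1) * h k * (h k)⁻¹ :=
        mul_le_mul_of_nonneg_right hs.2 (inv_nonneg.2 hhk.le)
      rw [mul_inv_cancel_right₀ hhk.ne'] at h1 h2
      constructor <;> linarith
    simp only [basisFun, hg, hR]
    rw [← Finset.mul_prod_erase _ _ (Finset.mem_univ k), Function.update_self,
      ← bspline_eq_piece hhk hp (a k) (c k) hs']
    congr 1
    · congr 1
      field_simp
      ring
    · refine Finset.prod_congr rfl fun l hl => ?_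
      rw [Function.update_of_ne (Finset.ne_of_mem_erase hl)]
      exact bspline_eq_piece (hh l) hp (a l) (c l) (ht l)
  have hpt : cellPoint h c t k * (h k)⁻¹ - c k = t k := by
    simp only [cellPoint]; field_simp; ring
  have hderiv : HasDerivAt g
      ((derivative (piece p (c k - a k))).eval (t k) * (h k)⁻¹ * R) (cellPoint h c t k) := by
    have h1 : HasDerivAt (fun s : ℝ => s * (h k)⁻¹ - c k) (h k)⁻¹ (cellPoint h c t k) := by
      simpa using ((hasDerivAt_id (cellPoint h c t k)).mul_const (h k)⁻¹).sub_const (c k : ℝ)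
    have h2 := (piece p (c k - a k)).hasDerivAt (cellPoint h c t k * (h k)⁻¹ - c k)
    rw [hpt] at h2
    exact (h2.comp_of_eq _ h1 hpt.symm).mul_const R
  rw [cellPartial, derivWithin_congr hEq (hEq hx), hderiv.hasDerivWithinAt.derivWithin
    (uniqueDiffOn_Icc (by nlinarith) _ hx), ← Finset.mul_prod_erase _ _ (Finset.mem_univ k)]
  have hrest : ∏ l ∈ Finset.univ.erase k, (gradPiece p k l (c l - a l)).eval (t l) = R :=
    Finset.prod_congr rfl fun l hl => by rw [gradPiece, if_neg (Finset.ne_of_mem_erase hl)]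
  rw [hrest, gradPiece, if_pos rfl]
  ring

theorem massForm_basisFun {d : ℕ} {h : Fin d → ℝ} (hh : ∀ k, 0 < h k) {p : ℕ} (hp : 1 ≤ p)
    {Q : Rule} (hQ : ∀ x ∈ Q.support, x ∈ Set.Icc (0 : ℝ) 1) (a : Fin d → ℤ) :
    massForm Q h (basisFun p h a) (basisFun p h 0) =
      (∏ k, h k) * ∏ l, form1 Q p (piece p) (a l) := by
  have hs := (hasSum_prod_quad Q p (fun _ => piece p) (fun _ => piece_eq_zero_of_notMem p)
    a).mul_left (∏ k, h k)
  rw [massForm, ← hs.tsum_eq]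
  refine tsum_congr fun c => ?_
  rw [← sum_piFinset_quad, Finset.mul_sum]
  refine Finset.sum_congr rfl fun t ht => ?_
  have ht' : ∀ k, t k ∈ Set.Icc (0 : ℝ) 1 := fun k => hQ _ (Fintype.mem_piFinset.1 ht k)
  rw [basisFun_cellPoint hh hp a c ht', basisFun_cellPoint hh hp 0 c ht']
  simp only [Pi.zero_apply, sub_zero]
  ring

theorem stiffForm_basisFun {d : ℕ} {h : Fin d → ℝ} (hh : ∀ k, 0 < h k) {p : ℕ} (hp : 1 ≤ p)
    {Q : Rule} (hQ : ∀ x ∈ Q.support, x ∈ Set.Icc (0 : ℝ) 1) (a : Fin d → ℤ) :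
    stiffForm Q h (basisFun p h a) (basisFun p h 0) =
      ∑ k, (h k)⁻¹ ^ 2 * (∏ k, h k) * ∏ l, form1 Q p (gradPiece p k l) (a l) := by
  have hs := hasSum_sum (s := Finset.univ) fun (k : Fin d) _ =>
    (hasSum_prod_quad Q p (gradPiece p k) (gradPiece_eq_zero p k) a).mul_left
      ((h k)⁻¹ ^ 2 * ∏ k, h k)
  rw [stiffForm, ← hs.tsum_eq]
  refine tsum_congr fun c => ?_
  simp only [← sum_piFinset_quad, Finset.mul_sum]
  rw [Finset.sum_comm]
  refine Finset.sum_congr rfl fun k _ => Finset.sum_congr rfl fun t ht => ?_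
  have ht' : ∀ k, t k ∈ Set.Icc (0 : ℝ) 1 := fun k => hQ _ (Fintype.mem_piFinset.1 ht k)
  rw [cellPartial_basisFun hh hp a c k ht', cellPartial_basisFun hh hp 0 c k ht']
  simp only [Pi.zero_apply, sub_zero]
  ring

/-! ### Approximate squared frequencies -/

lemma quad_piece_eq_massSymbol {p : ℕ} (hp1 : 1 ≤ p) (hp7 : p ≤ 7) {Q : Rule}
    (hQ : Q ∈ optimalRules p) (θ : ℝ) :
    quad Q (normSqSum p (piece p) (Complex.exp (-(θ * Complex.I)))) = massSymbol p θ := by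
  rw [quad_optimalRules hp1 hp7 hQ (natDegree_normSqSum_piece_le p _), coeff_normSqSum_piece,
    normSq_one_sub_cexp, massSymbol]
  have : (p.factorial : ℝ) ≠ 0 := by positivity
  field_simp

lemma quad_derivative_piece_eq_stiffSymbol {p : ℕ} (hp7 : p + 1 ≤ 7) {Q : Rule}
    (hQ : Q ∈ optimalRules (p + 1)) (θ : ℝ) :
    quad Q (normSqSum (p + 1) (fun i => derivative (piece (p + 1) i))
      (Complex.exp (-(θ * Complex.I)))) = stiffSymbol p θ := by
  have hdeg := natDegree_normSqSum_piece_le p (Complex.exp (-(θ * Complex.I)))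
  rw [normSqSum_derivative_piece, quad_optimalRules (by omega) hp7 hQ
    ((natDegree_smul_le _ _).trans (hdeg.trans (by omega))), coeff_smul,
    coeff_eq_zero_of_natDegree_lt (by omega), map_smul, normSq_one_sub_cexp, stiffSymbol]
  simp

/-- The approximate squared frequency is a sum of one-dimensional Rayleigh quotients. -/
theorem IsApproxSqFreq.eq_sum {d p : ℕ} (hp7 : p + 1 ≤ 7) {Q : Rule}
    (hQ : Q ∈ optimalRules (p + 1)) {h κ : Fin d → ℝ} (hh : ∀ k, 0 < h k)
    (hM : ∀ k, massSymbol (p + 1) (κ k * h k) ≠ 0) {lamt : ℝ}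
    (hl : IsApproxSqFreq (p + 1) Q h κ lamt) :
    lamt = ∑ k, (h k)⁻¹ ^ 2 *
      (stiffSymbol p (κ k * h k) / massSymbol (p + 1) (κ k * h k)) := by
  have hp1 : 1 ≤ p + 1 := by omega
  have hsupp := support_optimalRules hp1 hQ
  have hmass : ∑' a : Fin d → ℤ, waveCoeff h κ a *
      (massForm Q h (basisFun (p + 1) h a) (basisFun (p + 1) h 0) : ℂ) =
      ((∏ k, h k : ℝ) : ℂ) * ((∏ l, massSymbol (p + 1) (κ l * h l) : ℝ) : ℂ) := by
    have hs := (hasSum_waveCoeff_mul_prod_form1 Q (p + 1) (fun _ => piece (p + 1))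
      (fun _ => piece_eq_zero_of_notMem (p + 1)) h κ).mul_left ((∏ k, h k : ℝ) : ℂ)
    simp only [quad_piece_eq_massSymbol hp1 hp7 hQ] at hs
    rw [← hs.tsum_eq]
    refine tsum_congr fun a => ?_
    rw [massForm_basisFun hh hp1 hsupp, Complex.ofReal_mul]
    ring
  have hgrad : ∀ k l : Fin d, quad Q (normSqSum (p + 1) (gradPiece (p + 1) k l)
      (Complex.exp (-((κ l * h l : ℝ) * Complex.I)))) =
      if l = k then stiffSymbol p (κ l * h l) else massSymbol (p + 1) (κ l * h l) := by
    intro k l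
    split_ifs with hlk
    · rw [← quad_derivative_piece_eq_stiffSymbol hp7 hQ]
      have : gradPiece (p + 1) k l = fun i => derivative (piece (p + 1) i) :=
        funext fun i => if_pos hlk
      rw [this]
    · rw [← quad_piece_eq_massSymbol hp1 hp7 hQ]
      have : gradPiece (p + 1) k l = piece (p + 1) := funext fun i => if_neg hlk
      rw [this]
  have hstiff : ∑' a : Fin d → ℤ, waveCoeff h κ a *
      (stiffForm Q h (basisFun (p + 1) h a) (basisFun (p + 1) h 0) : ℂ) =
      ∑ k, (((h k)⁻¹ ^ 2 * ∏ k, h k : ℝ) : ℂ) *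
        ((∏ l, if l = k then stiffSymbol p (κ l * h l) else
          massSymbol (p + 1) (κ l * h l) : ℝ) : ℂ) := by
    have hs := hasSum_sum (s := Finset.univ) fun (k : Fin d) _ =>
      (hasSum_waveCoeff_mul_prod_form1 Q (p + 1) (gradPiece (p + 1) k)
        (gradPiece_eq_zero (p + 1) k) h κ).mul_left (((h k)⁻¹ ^ 2 * ∏ k, h k : ℝ) : ℂ)
    simp only [hgrad] at hs
    rw [← hs.tsum_eq]
    refine tsum_congr fun a => ?_
    rw [stiffForm_basisFun hh hp1 hsupp, Complex.ofReal_sum, Finset.mul_sum]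
    refine Finset.sum_congr rfl fun k _ => ?_
    rw [Complex.ofReal_mul]
    ring
  have heq := hl 0
  rw [hmass, hstiff] at heq
  norm_cast at heq
  have hH : ∏ k, h k ≠ 0 := Finset.prod_ne_zero_iff.2 fun k _ => (hh k).ne'
  have hMp : ∏ l, massSymbol (p + 1) (κ l * h l) ≠ 0 :=
    Finset.prod_ne_zero_iff.2 fun k _ => hM k
  have hprod : ∀ k : Fin d, (∏ l, if l = k then stiffSymbol p (κ l * h l) else
      massSymbol (p + 1) (κ l * h l)) = stiffSymbol p (κ k * h k) /
        massSymbol (p + 1) (κ k * h k) * ∏ l, massSymbol (p + 1) (κ l * h l) := by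
    intro k
    rw [← Finset.mul_prod_erase _ _ (Finset.mem_univ k), if_pos rfl,
      ← Finset.mul_prod_erase _ (fun l => massSymbol (p + 1) (κ l * h l)) (Finset.mem_univ k),
      ← mul_assoc, div_mul_cancel₀ _ (hM k)]
    congr 1
    exact Finset.prod_congr rfl fun l hl => if_neg (Finset.ne_of_mem_erase hl)
  apply mul_right_cancel₀ (mul_ne_zero hH hMp)
  rw [← heq, Finset.sum_mul]
  refine Finset.sum_congr rfl fun k _ => ?_
  rw [hprod]
  ring

end IGA

end

theorem mainTheorem1 (d : ℕ) (hd1 : 1 ≤ d) (hd3 : d ≤ 3) (p : ℕ) (hp1 : 1 ≤ p) (hp7 : p ≤ 7) :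
    ∃ C : ℝ, ∀ Q ∈ IGA.optimalRules p, ∀ j : ℕ, 1 ≤ j →
      ∀ N : Fin d → ℕ, (∀ k, 0 < N k) →
      ∀ hk : Fin d → ℝ, (∀ k, hk k = 1 / (N k : ℝ)) →
      ∀ h : ℝ, h = Real.sqrt (∑ k, hk k ^ 2) →
      ∀ κ : Fin d → ℝ, ∑ k, κ k ^ 2 = IGA.eigenvalue d j →
      ∀ lamt : ℝ, IGA.IsApproxSqFreq p Q hk κ lamt →
        max (Real.sqrt (IGA.eigenvalue d j) * h) (Real.sqrt lamt * h) < 1 →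
        |lamt - IGA.eigenvalue d j| ≤ C * h ^ (2 * p + 2) * IGA.eigenvalue d j ^ (p + 2) := by
  obtain ⟨q, rfl⟩ : ∃ q, p = q + 1 := ⟨p - 1, by omega⟩
  obtain ⟨C, hC, hdisp⟩ := IGA.exists_dispersion_bound q
  refine ⟨d * C, fun Q hQ j _ N hN hk hkN h hh κ hκ lamt hl hmax => ?_⟩
  rw [← hκ] at hmax ⊢
  set lam := ∑ k, κ k ^ 2 with hlam
  have hlam0 : 0 ≤ lam := Finset.sum_nonneg fun k _ => sq_nonneg _
  have hkpos : ∀ k, 0 < hk k := fun k => by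
    rw [hkN]; have := hN k; positivity
  have hh0 : 0 ≤ h := hh ▸ Real.sqrt_nonneg _
  have hsq : h ^ 2 = ∑ k, hk k ^ 2 := by
    rw [hh, Real.sq_sqrt (Finset.sum_nonneg fun k _ => sq_nonneg _)]
  have hk_le : ∀ k, hk k ^ 2 ≤ h ^ 2 := fun k => by
    rw [hsq]; exact Finset.single_le_sum (fun k _ => sq_nonneg (hk k)) (Finset.mem_univ k)
  have hκ_le : ∀ k, κ k ^ 2 ≤ lam := fun k =>
    Finset.single_le_sum (fun k _ => sq_nonneg (κ k)) (Finset.mem_univ k)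
  have hlamh : lam * h ^ 2 ≤ 1 := by
    have h1 := (lt_of_le_of_lt (le_max_left _ _) hmax).le
    have h2 : (Real.sqrt lam * h) ^ 2 ≤ 1 := pow_le_one₀ (by positivity) h1
    rwa [mul_pow, Real.sq_sqrt hlam0] at h2
  have hθ : ∀ k, |κ k * hk k| ≤ 1 := fun k => by
    rw [← sq_le_one_iff_abs_le_one, mul_pow]
    exact (mul_le_mul (hκ_le k) (hk_le k) (sq_nonneg _) hlam0).trans hlamh
  rw [hl.eq_sum hp7 hQ hkpos fun k => (hdisp _ (hθ k)).1.ne', hlam,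
    ← Finset.sum_sub_distrib, ← hlam]
  have hterm : ∀ k, |(hk k)⁻¹ ^ 2 * (IGA.stiffSymbol q (κ k * hk k) /
      IGA.massSymbol (q + 1) (κ k * hk k)) - κ k ^ 2| ≤
      C * h ^ (2 * (q + 1) + 2) * lam ^ (q + 1 + 2) := by
    intro k
    have hk0 := (hkpos k).ne'
    have e : (hk k)⁻¹ ^ 2 * (IGA.stiffSymbol q (κ k * hk k) /
        IGA.massSymbol (q + 1) (κ k * hk k)) - κ k ^ 2 =
        (hk k)⁻¹ ^ 2 * (IGA.stiffSymbol q (κ k * hk k) /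
        IGA.massSymbol (q + 1) (κ k * hk k) - (κ k * hk k) ^ 2) := by
      field_simp
    rw [e, abs_mul, abs_of_nonneg (by positivity)]
    calc (hk k)⁻¹ ^ 2 * |IGA.stiffSymbol q (κ k * hk k) /
          IGA.massSymbol (q + 1) (κ k * hk k) - (κ k * hk k) ^ 2|
        ≤ (hk k)⁻¹ ^ 2 * (C * ((κ k * hk k) ^ 2) ^ (q + 3)) := by
          gcongr; exact (hdisp _ (hθ k)).2
      _ = C * (hk k ^ 2) ^ (q + 2) * (κ k ^ 2) ^ (q + 3) := by
          rw [mul_pow, mul_pow _ _ (q + 3), pow_succ (hk k ^ 2) (q + 2)]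
          field_simp
      _ ≤ C * (h ^ 2) ^ (q + 2) * lam ^ (q + 3) := by
          have h1 := pow_le_pow_left₀ (sq_nonneg (hk k)) (hk_le k) (q + 2)
          have h2 := pow_le_pow_left₀ (sq_nonneg (κ k)) (hκ_le k) (q + 3)
          exact mul_le_mul (mul_le_mul_of_nonneg_left h1 hC) h2 (by positivity) (by positivity)
      _ = C * h ^ (2 * (q + 1) + 2) * lam ^ (q + 1 + 2) := by
          rw [← pow_mul]; ring_nf
  refine (Finset.abs_sum_le_sum_abs _ _).trans
    ((Finset.sum_le_sum fun k _ => hterm k).trans (le_of_eq ?_))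
  simp only [Finset.sum_const, Finset.card_univ, Fintype.card_fin, nsmul_eq_mul]
  ring
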